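/- Let $n,k,t$ be positive integers with $k\ge 2$ and $n\ge k+1$. Let $R(g)=(\mathrm Z^g)^{\otimes n}$, $g\in\mathbb Z_2=\{0,1\}$, be the representation of $\mathbb Z_2$ on $n$ qubits, where $\mathrm Z=\mathrm{diag}(1,-1)$, and let $\mathcal U_{n,G,R}$ be the compact group of all $n$-qubit unitaries commuting with $R(g)$ for all $g\in G=\mathbb Z_2$. Let $\Gamma$ be a set of subsets of $\{1,\dots,n\}$ with $\max_{\gamma\in\Gamma}\#\gamma=k$ which is inseparable, i.e. there are no nonempty disjoint sets $C_1,C_2$ with $C_1\cup C_2=\{1,\dots,n\}$ such that every $\gamma\in\Gamma$ satisfies $\gamma\subset C_1$ or $\gamma\subset C_2$. For $\gamma\in\Gamma$ let $\mathcal U^\gamma_{n,G,R}$ be the group of those $U\in\mathcal U_{n,G,R}$ that act only on the qubits in $\gamma$ (i.e. $U=V\otimes I$ with $V$ a unitary on these qubits), and let $p^\gamma>0$ with $\sum_{\gamma\in\Gamma}p^\gamma=1$. Let $$\zeta:=\sum_{\gamma\in\Gamma}p^\gamma\,\mu_{\mathcal U^\gamma_{n,G,R}}$$ be the distribution on $\mathcal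 U_{n,G,R}$ of one step of the $(G,R)$-symmetric $k$-local random circuit, where $\mu_{\mathcal S}$ denotes the normalized Haar measure on a compact group $\mathcal S$. For a distribution $\nu$ on $\mathcal U_{n,G,R}$ put $$M_{t,\nu}:=\int U^{\otimes t}\otimes (U^{*})^{\otimes t}\,d\nu(U),$$ with $U^*$ the entrywise complex conjugate of $U$. Then $\zeta$ is an asymptotic $(G,R)$-symmetric unitary $t$-design, i.e. $$\lim_{D\to\infty}(M_{t,\zeta})^D=M_{t,\mu_{\mathcal U_{n,G,R}}},$$ if and only if $t<2^{n-1}$. In particular the condition on $t$ does not depend on $k$. -/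

import Mathlib

open scoped Matrix Kronecker Topology

noncomputable section

namespace SymDesign

/-! ## Tensor powers of matrices -/

/-- The tensor power `A^{⊗ m}`: its rows and columns are indexed by `m`-tuples of indices. -/
def tensorPow {ι : Type} (m : ℕ) (A : Matrix ι ι ℂ) : Matrix (Fin m → ι) (Fin m → ι) ℂ :=
  Matrix.of fun a b => ∏ i, A (a i) (b i)

theorem tensorPow_mul {ι : Type} [Fintype ι] (m : ℕ) (A B : Matrix ι ι ℂ) :
    tensorPow m (A * B) = tensorPow m A * tensorPow m B := by
  classical
  ext a b
  simp only [tensorPow, Matrix.of_apply, Matrix.mul_apply, Finset.prod_univ_sum,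
    Fintype.piFinset_univ, Finset.prod_mul_distrib]

theorem tensorPow_one {ι : Type} [DecidableEq ι] (m : ℕ) :
    tensorPow m (1 : Matrix ι ι ℂ) = 1 := by
  ext a b
  simp only [tensorPow, Matrix.of_apply, Matrix.one_apply]
  by_cases h : a = b
  · simp [h]
  · obtain ⟨i, hi⟩ := Function.ne_iff.mp h
    rw [if_neg h]
    exact Finset.prod_eq_zero (Finset.mem_univ i) (if_neg hi)

theorem tensorPow_star {ι : Type} (m : ℕ) (A : Matrix ι ι ℂ) :
    star (tensorPow m A) = tensorPow m (star A) := by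
  ext a b
  simp [tensorPow, Matrix.star_apply]

theorem tensorPow_mem_unitaryGroup {ι : Type} [Fintype ι] [DecidableEq ι] (m : ℕ)
    {A : Matrix ι ι ℂ} (hA : A ∈ Matrix.unitaryGroup ι ℂ) :
    tensorPow m A ∈ Matrix.unitaryGroup (Fin m → ι) ℂ := by
  rw [Matrix.mem_unitaryGroup_iff] at hA ⊢
  rw [tensorPow_star, ← tensorPow_mul, hA, tensorPow_one]

/-! ## Topology and Borel structure of the unitary group -/

instance instMeasurableSpaceUnitaryGroup {ι : Type} [Fintype ι] [DecidableEq ι] :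
    MeasurableSpace (Matrix.unitaryGroup ι ℂ) := borel _

instance instBorelSpaceUnitaryGroup {ι : Type} [Fintype ι] [DecidableEq ι] :
    BorelSpace (Matrix.unitaryGroup ι ℂ) := ⟨rfl⟩

instance instCompactSpaceUnitaryGroup {ι : Type} [Fintype ι] [DecidableEq ι] :
    CompactSpace (Matrix.unitaryGroup ι ℂ) := by
  refine isCompact_iff_compactSpace.mp ?_
  have hK : IsCompact (Set.pi Set.univ fun _ : ι => Set.pi Set.univ fun _ : ι =>
      Metric.closedBall (0 : ℂ) 1) :=
    isCompact_univ_pi fun _ => isCompact_univ_pi fun _ => isCompact_closedBall 0 1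
  refine IsCompact.of_isClosed_subset hK (isClosed_unitary (R := Matrix ι ι ℂ)) ?_
  intro U hU i _ j _
  simpa using entry_norm_bound_of_unitary hU i j

/-! ## Symmetric unitaries, moment operators and asymptotic designs -/

/-- The normalized Haar measure of a compact group. -/
def haarProb (S : Type) [Group S] [TopologicalSpace S] [IsTopologicalGroup S] [CompactSpace S]
    [MeasurableSpace S] [BorelSpace S] : MeasureTheory.Measure S :=
  MeasureTheory.Measure.haarMeasure ⊤

/-- The group of all unitaries that commute with `R g` for every `g`. -/
def symUnitary {ι : Type} [Fintype ι] [DecidableEq ι] {G : Type} [Group G]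
    (R : G →* Matrix.unitaryGroup ι ℂ) : Subgroup (Matrix.unitaryGroup ι ℂ) :=
  Subgroup.centralizer (Set.range R)

instance instCompactSpaceSymUnitary {ι : Type} [Fintype ι] [DecidableEq ι] {G : Type} [Group G]
    (R : G →* Matrix.unitaryGroup ι ℂ) : CompactSpace (symUnitary R) := by
  have h : IsClosed (symUnitary R : Set (Matrix.unitaryGroup ι ℂ)) :=
    Set.isClosed_centralizer (Set.range R)
  exact isCompact_iff_compactSpace.mp h.isCompact

/-- The moment operator `∫ U^{⊗ t} ⊗ (U^*)^{⊗ t} dν(U)`, where `U^*` is the entrywise complex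
conjugate of `U` and the integral is taken entry by entry. -/
def momentOp {ι : Type} [Fintype ι] [DecidableEq ι] {G : Type} [Group G]
    (R : G →* Matrix.unitaryGroup ι ℂ) (t : ℕ) (ν : MeasureTheory.Measure (symUnitary R)) :
    Matrix ((Fin t → ι) × (Fin t → ι)) ((Fin t → ι) × (Fin t → ι)) ℂ :=
  Matrix.of fun a b => ∫ U : symUnitary R,
    (tensorPow t (U : Matrix ι ι ℂ) ⊗ₖ tensorPow t ((U : Matrix ι ι ℂ).map star)) a b ∂ν

/-- `ν` is an asymptotic `(G, R)`-symmetric unitary `t`-design: the powers of its `t`-th moment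
operator converge to the `t`-th moment operator of the normalized Haar measure on the group of
symmetric unitaries. -/
def IsAsymptoticSymmetricDesign {ι : Type} [Fintype ι] [DecidableEq ι] {G : Type} [Group G]
    (R : G →* Matrix.unitaryGroup ι ℂ) (t : ℕ) (ν : MeasureTheory.Measure (symUnitary R)) : Prop :=
  Filter.Tendsto (fun D : ℕ => momentOp R t ν ^ D) Filter.atTop
    (𝓝 (momentOp R t (haarProb (symUnitary R))))

/-! ## Local gates on `n` qubits; the computational basis is indexed by `Fin n → Fin 2` -/

/-- The bijection between bit strings on all qubits and pairs of bit strings on `γ` and on its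
complement. -/
def splitBits {n : ℕ} (γ : Finset (Fin n)) :
    (Fin n → Fin 2) ≃ ({q // q ∈ γ} → Fin 2) × ({q // q ∉ γ} → Fin 2) :=
  Equiv.piEquivPiSubtypeProd (fun q => q ∈ γ) (fun _ => Fin 2)

/-- The embedding `V ↦ V ⊗ I` of the operators on the qubits in `γ` into those on all qubits. -/
def embedMatrix {n : ℕ} (γ : Finset (Fin n))
    (V : Matrix ({q // q ∈ γ} → Fin 2) ({q // q ∈ γ} → Fin 2) ℂ) :
    Matrix (Fin n → Fin 2) (Fin n → Fin 2) ℂ :=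
  (V ⊗ₖ (1 : Matrix ({q // q ∉ γ} → Fin 2) ({q // q ∉ γ} → Fin 2) ℂ)).submatrix
    (splitBits γ) (splitBits γ)

theorem embedMatrix_mul {n : ℕ} (γ : Finset (Fin n))
    (V W : Matrix ({q // q ∈ γ} → Fin 2) ({q // q ∈ γ} → Fin 2) ℂ) :
    embedMatrix γ (V * W) = embedMatrix γ V * embedMatrix γ W := by
  rw [embedMatrix, embedMatrix, embedMatrix, Matrix.submatrix_mul_equiv, ← Matrix.mul_kronecker_mul,
    Matrix.one_mul]

theorem embedMatrix_one {n : ℕ} (γ : Finset (Fin n)) : embedMatrix γ 1 = 1 := by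
  rw [embedMatrix, Matrix.one_kronecker_one, Matrix.submatrix_one_equiv]

theorem embedMatrix_star {n : ℕ} (γ : Finset (Fin n))
    (V : Matrix ({q // q ∈ γ} → Fin 2) ({q // q ∈ γ} → Fin 2) ℂ) :
    star (embedMatrix γ V) = embedMatrix γ (star V) := by
  simp only [embedMatrix, Matrix.star_eq_conjTranspose, Matrix.conjTranspose_submatrix,
    Matrix.conjTranspose_kronecker, Matrix.conjTranspose_one]

/-- The embedding `V ↦ V ⊗ I` as a homomorphism of unitary groups. -/
def embedUnitary {n : ℕ} (γ : Finset (Fin n)) :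
    Matrix.unitaryGroup ({q // q ∈ γ} → Fin 2) ℂ →* Matrix.unitaryGroup (Fin n → Fin 2) ℂ where
  toFun V := ⟨embedMatrix γ V, by
    have hV := Matrix.mem_unitaryGroup_iff.mp V.2
    rw [Matrix.mem_unitaryGroup_iff, embedMatrix_star, ← embedMatrix_mul, hV, embedMatrix_one]⟩
  map_one' := Subtype.ext (embedMatrix_one γ)
  map_mul' V W := Subtype.ext (embedMatrix_mul γ V W)

theorem continuous_embedUnitary {n : ℕ} (γ : Finset (Fin n)) : Continuous (embedUnitary γ) := by
  refine Continuous.subtype_mk ?_ _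
  refine continuous_pi fun a => continuous_pi fun b => ?_
  simp only [embedMatrix, Matrix.submatrix_apply, Matrix.kroneckerMap_apply]
  exact ((continuous_subtype_val.matrix_elem _ _).mul continuous_const)

/-- The symmetric unitaries that act only on the qubits in `γ`, as a subgroup of the group of all
symmetric unitaries. -/
def localSymUnitary {n : ℕ} {G : Type} [Group G]
    (R : G →* Matrix.unitaryGroup (Fin n → Fin 2) ℂ) (γ : Finset (Fin n)) :
    Subgroup (symUnitary R) :=
  (embedUnitary γ).range.subgroupOf (symUnitary R)

instance instCompactSpaceLocalSymUnitary {n : ℕ} {G : Type} [Group G]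
    (R : G →* Matrix.unitaryGroup (Fin n → Fin 2) ℂ) (γ : Finset (Fin n)) :
    CompactSpace (localSymUnitary R γ) := by
  have h1 : IsClosed (Set.range (embedUnitary γ)) :=
    (isCompact_range (continuous_embedUnitary γ)).isClosed
  have h2 : IsClosed (localSymUnitary R γ : Set (symUnitary R)) :=
    h1.preimage continuous_subtype_val
  exact isCompact_iff_compactSpace.mp h2.isCompact

/-- The distribution of one step of the symmetric local random circuit: choose `γ ∈ Γ` with
probability `p γ`, then draw a Haar random symmetric unitary acting on the qubits in `γ`. -/
def circuitDist {n : ℕ} {G : Type} [Group G]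
    (R : G →* Matrix.unitaryGroup (Fin n → Fin 2) ℂ) (Γ : Finset (Finset (Fin n)))
    (p : Finset (Fin n) → ℝ) : MeasureTheory.Measure (symUnitary R) :=
  ∑ γ ∈ Γ, ENNReal.ofReal (p γ) •
    (haarProb (localSymUnitary R γ)).map (Subtype.val : localSymUnitary R γ → symUnitary R)

/-- `Γ` is inseparable: the qubits cannot be split into two nonempty parts such that every member
of `Γ` lies in one of the parts. -/
def InseparableSupports {n : ℕ} (Γ : Finset (Finset (Fin n))) : Prop :=
  ¬ ∃ C₁ C₂ : Finset (Fin n), C₁.Nonempty ∧ C₂.Nonempty ∧ C₁ ∩ C₂ = ∅ ∧ C₁ ∪ C₂ = Finset.univ ∧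
    ∀ γ ∈ Γ, γ ⊆ C₁ ∨ γ ⊆ C₂

/-! ## The representation of the group with two elements -/

/-- The Pauli operator `Z`. -/
def pauliZ : Matrix (Fin 2) (Fin 2) ℂ := !![1, 0; 0, -1]

theorem pauliZ_mul_self : pauliZ * pauliZ = 1 := by
  ext i j
  fin_cases i <;> fin_cases j <;> simp [pauliZ, Matrix.mul_apply]

theorem pauliZ_star : star pauliZ = pauliZ := by
  ext i j
  fin_cases i <;> fin_cases j <;> simp [pauliZ, Matrix.star_apply]

theorem pauliZ_pow_mem (m : ℕ) : pauliZ ^ m ∈ Matrix.unitaryGroup (Fin 2) ℂ :=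
  pow_mem (Matrix.mem_unitaryGroup_iff.mpr (by rw [pauliZ_star, pauliZ_mul_self])) m

theorem pauliZ_pow_val_add (g h : ZMod 2) :
    pauliZ ^ (g + h).val = pauliZ ^ g.val * pauliZ ^ h.val := by
  rw [ZMod.val_add, ← pow_add]
  conv_rhs => rw [← Nat.div_add_mod (g.val + h.val) 2, pow_add, pow_mul, pow_two, pauliZ_mul_self,
    one_pow, one_mul]

/-- The representation `R(g) = (Z^g)^{⊗ n}` of `ℤ/2ℤ` on `n` qubits. -/
def z2Rep (n : ℕ) : Multiplicative (ZMod 2) →* Matrix.unitaryGroup (Fin n → Fin 2) ℂ where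
  toFun g := ⟨tensorPow n (pauliZ ^ (Multiplicative.toAdd g).val),
    tensorPow_mem_unitaryGroup n (pauliZ_pow_mem _)⟩
  map_one' := Subtype.ext (by
    change tensorPow n (pauliZ ^ (Multiplicative.toAdd (1 : Multiplicative (ZMod 2))).val) = 1
    rw [toAdd_one, ZMod.val_zero, pow_zero, tensorPow_one])
  map_mul' g h := Subtype.ext (by
    change tensorPow n (pauliZ ^ (Multiplicative.toAdd (g * h)).val) = _
    rw [toAdd_mul, pauliZ_pow_val_add, tensorPow_mul]
    rfl)

end SymDesign

end

/-! A vector fixed by `U^{⊗t} ⊗ (U^*)^{⊗t}` is the same as an operator `T` commuting with `U^{⊗t}`.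
The Haar average over a compact group is the orthogonal projection onto its fixed vectors, so the
moment operator of the circuit is a convex combination of projections with positive weights, and its
powers converge to the projection onto the common fixed vectors (`tendsto_pow_convex_combination`).
Hence the design property says exactly that every `T` commuting with the `t`-th tensor powers of all
local gates commutes with those of all symmetric unitaries.

Sufficiency. Differentiating along local gates, `T` commutes with the derived action of the
generators `Z_i`, `Z_i Z_j` and `X_i X_j` inside each support. Commutators spread these over all
qubits because `Γ` is inseparable, and yield every Pauli operator `X^a Z^b` with `a` of even weight
except `Z^{⊗n}` (`CommutatorClosed.even`; the identity is trivial). The missing direction is the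
relative phase of the two parity sectors. For `t < 2^(n-1)` it comes for free: the weights of the
other diagonal generators determine that of `Z^{⊗n}` on `t`-tuples of bit strings, since a tuple
that short misses a string of each parity (`sum_parity_eq`). All symmetric generators then commute
with `T`, and a symmetric unitary is the exponential of one.

Necessity. Every support misses a qubit `i`. The flip of `i` commutes with the gate and swaps the
parity sectors, so the gate has equal determinants on both. The character `det_even * conj det_odd`
occurs in the moment representation of degree `2^(n-1)`, on a product of two antisymmetric tensors,
and in every higher degree. It is trivial on all gates but not on all symmetric unitaries, so the
circuit fixes a vector that the full group does not. -/

noncomputable section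

namespace SymDesign

/-! ## Tensor products of families of matrices and the derived action -/

/-- The tensor product of a family of matrices, as a monoid homomorphism. -/
def tensorFamily {ι : Type} [Fintype ι] [DecidableEq ι] (t : ℕ) :
    (Fin t → Matrix ι ι ℂ) →* Matrix (Fin t → ι) (Fin t → ι) ℂ where
  toFun F := Matrix.of fun a b => ∏ i, F i (a i) (b i)
  map_one' := tensorPow_one t
  map_mul' F G := by
    ext a b
    simp only [Matrix.of_apply, Matrix.mul_apply, Finset.prod_univ_sum, Pi.mul_apply,
      Fintype.piFinset_univ, Finset.prod_mul_distrib]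

section TensorFamily

variable {ι : Type} [Fintype ι] [DecidableEq ι] {t : ℕ}

theorem tensorFamily_const (A : Matrix ι ι ℂ) :
    tensorFamily t (fun _ => A) = tensorPow t A := rfl

theorem tensorFamily_mulSingle_apply (i : Fin t) (A : Matrix ι ι ℂ) (a b : Fin t → ι) :
    tensorFamily t (Pi.mulSingle i A) a b =
      (∏ j ∈ Finset.univ.erase i, (1 : Matrix ι ι ℂ) (a j) (b j)) * A (a i) (b i) := by
  change ∏ j, (Pi.mulSingle i A : Fin t → Matrix ι ι ℂ) j (a j) (b j) = _
  rw [← Finset.prod_erase_mul _ _ (Finset.mem_univ i), Pi.mulSingle_eq_same]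
  congr 1
  refine Finset.prod_congr rfl fun j hj => ?_
  rw [Pi.mulSingle_eq_of_ne (Finset.ne_of_mem_erase hj)]

/-- The action of a matrix on the `i`-th tensor factor. -/
def site (i : Fin t) : Matrix ι ι ℂ →ₐ[ℂ] Matrix (Fin t → ι) (Fin t → ι) ℂ :=
  AlgHom.ofLinearMap
    { toFun := fun A => tensorFamily t (Pi.mulSingle i A)
      map_add' := fun A B => by
        ext a b
        simp only [Matrix.add_apply, tensorFamily_mulSingle_apply, mul_add]
      map_smul' := fun c A => by
        ext a b
        simp only [Matrix.smul_apply, tensorFamily_mulSingle_apply, smul_eq_mul, RingHom.id_apply]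
        ring }
    (by simp) (fun A B => by simp [Pi.mulSingle_mul])

theorem site_apply (i : Fin t) (A : Matrix ι ι ℂ) :
    site i A = tensorFamily t (Pi.mulSingle i A) := rfl

theorem site_commute {i j : Fin t} (h : i ≠ j) (A B : Matrix ι ι ℂ) :
    Commute (site i A) (site j B) :=
  (Pi.mulSingle_commute (f := fun _ : Fin t => Matrix ι ι ℂ) h A B).map (tensorFamily t)

/-- The action of a matrix on the tensor power as a derivation. -/
def lieAct (t : ℕ) : Matrix ι ι ℂ →ₗ[ℂ] Matrix (Fin t → ι) (Fin t → ι) ℂ :=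
  ∑ i : Fin t, (site i).toLinearMap

theorem lieAct_eq_sum (A : Matrix ι ι ℂ) : lieAct t A = ∑ i : Fin t, site i A := by
  simp [lieAct]

/-- Actions on different sites commute, so only the diagonal terms of the double sum survive. -/
theorem lieAct_bracket (A B : Matrix ι ι ℂ) :
    lieAct t (A * B - B * A) = lieAct t A * lieAct t B - lieAct t B * lieAct t A := by
  simp only [lieAct_eq_sum, Finset.sum_mul_sum]
  rw [Finset.sum_comm (f := fun i j : Fin t => site i B * site j A), ← Finset.sum_sub_distrib]
  refine Finset.sum_congr rfl fun i _ => ?_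
  rw [← Finset.sum_sub_distrib, Finset.sum_eq_single i]
  · rw [map_sub, map_mul, map_mul]
  · intro j _ hj
    rw [(site_commute hj.symm A B).eq, sub_self]
  · simp

theorem lieAct_diagonal (f : ι → ℂ) :
    lieAct t (Matrix.diagonal f) = Matrix.diagonal fun a => ∑ i, f (a i) := by
  ext a b
  simp only [lieAct_eq_sum, Matrix.sum_apply, site_apply, tensorFamily_mulSingle_apply]
  by_cases h : a = b
  · subst h
    simp
  · rw [Matrix.diagonal_apply_ne _ h]
    refine Finset.sum_eq_zero fun i _ => ?_
    obtain ⟨j, hj⟩ := Function.ne_iff.mp h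
    by_cases hij : j = i
    · subst hij
      simp [Matrix.diagonal_apply_ne _ hj]
    · refine mul_eq_zero_of_left
        (Finset.prod_eq_zero (Finset.mem_erase.mpr ⟨hij, Finset.mem_univ j⟩) ?_) _
      exact Matrix.one_apply_ne hj

-- The summands of `lieAct` commute, so the exponential of the sum is the product over the sites,
-- and each `site i` is a continuous algebra homomorphism.
open scoped Matrix.Norms.Operator in
theorem tensorPow_exp (X : Matrix ι ι ℂ) :
    tensorPow t (NormedSpace.exp X) = NormedSpace.exp (lieAct t X) := by
  have hc : (↑(Finset.univ : Finset (Fin t)) : Set (Fin t)).Pairwise (Function.onFun Commute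
      fun i => site i X) := fun i _ j _ h => site_commute h X X
  rw [lieAct_eq_sum, Matrix.exp_sum_of_commute _ _ hc, ← tensorFamily_const,
    ← Finset.noncommProd_mulSingle (fun _ : Fin t => NormedSpace.exp X)]
  refine (Finset.map_noncommProd _ _ _ (tensorFamily (ι := ι) t)).trans ?_
  refine Finset.noncommProd_congr rfl (fun i _ => ?_) _
  have hcont : Continuous (site i : Matrix ι ι ℂ →ₐ[ℂ] Matrix (Fin t → ι) (Fin t → ι) ℂ) :=
    (site i).toLinearMap.continuous_of_finiteDimensional
  exact NormedSpace.map_exp (site i) hcont X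

theorem hasDerivAt_tensorPow {E : ℝ → Matrix ι ι ℂ} {A : Matrix ι ι ℂ} (h0 : E 0 = 1)
    (hE : ∀ x y, HasDerivAt (fun s => E s x y) (A x y) 0) (a b : Fin t → ι) :
    HasDerivAt (fun s => tensorPow t (E s) a b) (lieAct t A a b) 0 := by
  have h := HasDerivAt.fun_finsetProd (u := Finset.univ) fun i _ => hE (a i) (b i)
  simp only [lieAct_eq_sum, Matrix.sum_apply, site_apply, tensorFamily_mulSingle_apply]
  simpa only [h0, smul_eq_mul, tensorPow, Matrix.of_apply] using h

/-- Differentiate the commutation relation at `s = 0`, entry by entry. -/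
theorem commute_lieAct_of_curve {T : Matrix (Fin t → ι) (Fin t → ι) ℂ} {E : ℝ → Matrix ι ι ℂ}
    {A : Matrix ι ι ℂ} (h0 : E 0 = 1) (hE : ∀ x y, HasDerivAt (fun s => E s x y) (A x y) 0)
    (hT : ∀ s, Commute T (tensorPow t (E s))) : Commute T (lieAct t A) := by
  ext a b
  have h1 : HasDerivAt (fun s => (T * tensorPow t (E s)) a b) ((T * lieAct t A) a b) 0 := by
    simp only [Matrix.mul_apply]
    exact HasDerivAt.fun_sum fun c _ => (hasDerivAt_tensorPow h0 hE c b).const_mul _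
  have h2 : HasDerivAt (fun s => (tensorPow t (E s) * T) a b) ((lieAct t A * T) a b) 0 := by
    simp only [Matrix.mul_apply]
    exact HasDerivAt.fun_sum fun c _ => (hasDerivAt_tensorPow h0 hE a c).mul_const _
  simp only [fun s => (hT s).eq] at h1
  exact h1.unique h2

end TensorFamily

/-! ## Logarithms of unitary matrices -/

-- The functional calculus makes the logarithm inherit the commutation relations of `U` and its
-- adjoint, so a symmetric unitary has a symmetric generator.
open scoped Matrix.Norms.L2Operator in
theorem exists_exp_eq_unitary {ι : Type} [Fintype ι] [DecidableEq ι]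
    (U : Matrix.unitaryGroup ι ℂ) : ∃ X : Matrix ι ι ℂ, NormedSpace.exp X = U ∧
      ∀ Z : Matrix ι ι ℂ, Commute (U : Matrix ι ι ℂ) Z → Commute (star (U : Matrix ι ι ℂ)) Z →
        Commute X Z := by
  -- The spectrum is finite, so the branch cut of the logarithm does no harm.
  have hcont : ∀ f : ℂ → ℂ, ContinuousOn f (spectrum ℂ (U : Matrix ι ι ℂ)) := fun f =>
    (Matrix.finite_spectrum _).continuousOn f
  have hn : IsStarNormal (U : Matrix ι ι ℂ) := by
    refine ⟨?_⟩
    rw [Commute, SemiconjBy, Matrix.mem_unitaryGroup_iff.mp U.2,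
      Matrix.mem_unitaryGroup_iff'.mp U.2]
  refine ⟨cfc Complex.log (U : Matrix ι ι ℂ), ?_, fun Z h1 h2 => h1.cfc h2 _⟩
  rw [← CFC.exp_eq_normedSpace_exp (𝕜 := ℂ) (cfc_predicate _ _),
    ← cfc_comp _ _ _ hn (by
      rw [← Complex.exp_eq_exp_ℂ]; exact Complex.continuous_exp.continuousOn) (hcont _)]
  conv_rhs => rw [← cfc_id ℂ (U : Matrix ι ι ℂ) hn]
  refine cfc_congr fun z hz => ?_
  have hz0 : z ≠ 0 := by
    rintro rfl
    have hu : IsUnit (U : Matrix ι ι ℂ) := ⟨Unitary.toUnits U, rfl⟩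
    exact spectrum.zero_notMem ℂ hu hz
  simp [← Complex.exp_eq_exp_ℂ, Complex.exp_log hz0]

/-! ## Averages over compact groups -/

section Average

variable {S : Type} [Group S] [TopologicalSpace S] [IsTopologicalGroup S] [CompactSpace S]
  [MeasurableSpace S] [BorelSpace S] {κ : Type} [Fintype κ] [DecidableEq κ]

instance instIsProbabilityMeasureHaarProb : MeasureTheory.IsProbabilityMeasure (haarProb S) :=
  ⟨MeasureTheory.Measure.haarMeasure_self (K₀ := (⊤ : TopologicalSpace.PositiveCompacts S))⟩

instance instIsMulLeftInvariantHaarProb : (haarProb S).IsMulLeftInvariant :=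
  inferInstanceAs (MeasureTheory.Measure.haarMeasure _).IsMulLeftInvariant

theorem integrable_haarProb {f : S → ℂ} (hf : Continuous f) :
    MeasureTheory.Integrable f (haarProb S) :=
  hf.integrable_of_hasCompactSupport (HasCompactSupport.of_compactSpace f)

/-- The Haar average of a matrix representation of a compact group. -/
def haarAvg (ψ : S →* Matrix κ κ ℂ) : Matrix κ κ ℂ :=
  Matrix.of fun a b => ∫ s, ψ s a b ∂(haarProb S)

theorem mul_haarAvg {ψ : S →* Matrix κ κ ℂ} (hψ : Continuous ψ) (g : S) :
    ψ g * haarAvg ψ = haarAvg ψ := by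
  ext a b
  have h : ∀ s, ψ (g * s) a b = ∑ c, ψ g a c * ψ s c b := fun s => by
    rw [map_mul, Matrix.mul_apply]
  have hi := MeasureTheory.integral_mul_left_eq_self (μ := haarProb S) (fun s => ψ s a b) g
  simp only [h] at hi
  rw [MeasureTheory.integral_finsetSum _ fun c _ =>
    (integrable_haarProb (hψ.matrix_elem c b)).const_mul _] at hi
  simp only [MeasureTheory.integral_const_mul] at hi
  simpa only [Matrix.mul_apply, haarAvg, Matrix.of_apply] using hi

theorem haarAvg_mulVec {ψ : S →* Matrix κ κ ℂ} (hψ : Continuous ψ) {v : κ → ℂ}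
    (hv : ∀ s, ψ s *ᵥ v = v) : haarAvg ψ *ᵥ v = v := by
  ext a
  have h : ∫ s, (ψ s *ᵥ v) a ∂(haarProb S) = v a := by simp [hv]
  simp only [Matrix.mulVec, dotProduct] at h
  rw [MeasureTheory.integral_finsetSum _ fun c _ =>
    (integrable_haarProb (hψ.matrix_elem a c)).mul_const _] at h
  simp only [MeasureTheory.integral_mul_const] at h
  simpa only [Matrix.mulVec, dotProduct, haarAvg, Matrix.of_apply] using h

/-- Each `(ψ s)ᴴ = ψ s⁻¹` is absorbed by the average. This one identity gives both self-adjointness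
and idempotence, using left invariance only. -/
theorem haarAvg_conjTranspose_mul_self {ψ : S →* Matrix κ κ ℂ} (hψ : Continuous ψ)
    (hu : ∀ s, ψ s⁻¹ = (ψ s)ᴴ) : (haarAvg ψ)ᴴ * haarAvg ψ = haarAvg ψ := by
  ext a b
  have h : ∫ s, (((ψ s)ᴴ * haarAvg ψ) a b) ∂(haarProb S) = haarAvg ψ a b := by
    simp [← hu, mul_haarAvg hψ]
  simp only [Matrix.mul_apply, Matrix.conjTranspose_apply] at h
  rw [MeasureTheory.integral_finsetSum _ fun c _ =>
    (integrable_haarProb (hψ.matrix_elem c a).star).mul_const _] at h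
  simp only [MeasureTheory.integral_mul_const] at h
  rw [← h, Matrix.mul_apply]
  refine Finset.sum_congr rfl fun c _ => ?_
  congr 1
  simp only [Matrix.conjTranspose_apply, haarAvg, Matrix.of_apply]
  exact integral_conj.symm

theorem haarAvg_isHermitian {ψ : S →* Matrix κ κ ℂ} (hψ : Continuous ψ)
    (hu : ∀ s, ψ s⁻¹ = (ψ s)ᴴ) : (haarAvg ψ).IsHermitian := by
  have h := haarAvg_conjTranspose_mul_self hψ hu
  rw [Matrix.IsHermitian, ← h, Matrix.conjTranspose_mul, Matrix.conjTranspose_conjTranspose]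

theorem haarAvg_mul_self {ψ : S →* Matrix κ κ ℂ} (hψ : Continuous ψ)
    (hu : ∀ s, ψ s⁻¹ = (ψ s)ᴴ) : haarAvg ψ * haarAvg ψ = haarAvg ψ := by
  have h := haarAvg_conjTranspose_mul_self hψ hu
  rwa [(haarAvg_isHermitian hψ hu).eq] at h

end Average

/-! ## Convex combinations of orthogonal projections -/

section Projections

open scoped ComplexOrder

variable {κ : Type} [Fintype κ]

theorem posSemidef_of_projection {P : Matrix κ κ ℂ} (h1 : P.IsHermitian) (h2 : P * P = P) :
    P.PosSemidef := by
  have h := Matrix.posSemidef_conjTranspose_mul_self P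
  rwa [h1.eq, h2] at h

variable [DecidableEq κ]

theorem posSemidef_one_sub_of_projection {P : Matrix κ κ ℂ} (h1 : P.IsHermitian)
    (h2 : P * P = P) : (1 - P).PosSemidef :=
  posSemidef_of_projection (Matrix.isHermitian_one.sub h1) (by
    rw [mul_sub, sub_mul, sub_mul, h2]; simp)

/-- The nonnegative numbers `⟨v, (1 - P j) v⟩` have a vanishing positive combination, so each is
zero. -/
theorem mulVec_eq_self_of_convex_combination {J : Type} {s : Finset J} {p : J → ℝ}
    (hp : ∀ j ∈ s, 0 < p j) (hsum : ∑ j ∈ s, p j = 1) {P : J → Matrix κ κ ℂ}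
    (h1 : ∀ j, (P j).IsHermitian) (h2 : ∀ j, P j * P j = P j) {v : κ → ℂ}
    (hv : (∑ j ∈ s, (p j : ℂ) • P j) *ᵥ v = v) {j : J} (hj : j ∈ s) : P j *ᵥ v = v := by
  have hQ := fun j => posSemidef_one_sub_of_projection (h1 j) (h2 j)
  have hzero : ∑ j ∈ s, (p j : ℂ) * (star v ⬝ᵥ ((1 - P j) *ᵥ v)) = 0 := by
    have : (∑ j ∈ s, (p j : ℂ) • (1 - P j)) *ᵥ v = 0 := by
      simp only [smul_sub, Finset.sum_sub_distrib, Matrix.sub_mulVec, hv]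
      rw [← Finset.sum_smul, ← Complex.ofReal_sum, hsum]
      simp
    have h := congrArg (star v ⬝ᵥ ·) this
    simpa only [Matrix.sum_mulVec, dotProduct_sum, Matrix.smul_mulVec, dotProduct_smul,
      smul_eq_mul, dotProduct_zero] using h
  have hj0 := (Finset.sum_eq_zero_iff_of_nonneg fun j hj =>
    mul_nonneg (Complex.zero_le_real.mpr (hp j hj).le) ((hQ j).dotProduct_mulVec_nonneg v)).mp
      hzero j hj
  have hj1 := (mul_eq_zero.mp hj0).resolve_left (Complex.ofReal_ne_zero.mpr (hp j hj).ne')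
  have hj2 := ((hQ j).dotProduct_mulVec_zero_iff v).mp hj1
  rw [Matrix.sub_mulVec, Matrix.one_mulVec, sub_eq_zero] at hj2
  exact hj2.symm

/-- The eigenvalues lie in `[0, 1]`, so their powers tend to `0` or `1`. -/
theorem tendsto_pow_of_posSemidef {M : Matrix κ κ ℂ} (h0 : M.PosSemidef)
    (h1 : (1 - M).PosSemidef) : ∃ Q : Matrix κ κ ℂ,
      Filter.Tendsto (fun D : ℕ => M ^ D) Filter.atTop (𝓝 Q) := by
  have hM := h0.1
  set φ := Unitary.conjStarAlgAut ℂ (Matrix κ κ ℂ) hM.eigenvectorUnitary with hφ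
  have hcont : Continuous φ :=
    (φ.toAlgEquiv.toLinearMap).continuous_of_finiteDimensional
  have hle : ∀ i, hM.eigenvalues i ≤ 1 := fun i => by
    have h2 := h1.dotProduct_mulVec_nonneg (hM.eigenvectorBasis i).ofLp
    have h3 := hM.mulVec_eigenvectorBasis i
    have h4 : star (hM.eigenvectorBasis i).ofLp ⬝ᵥ (hM.eigenvectorBasis i).ofLp = (1 : ℂ) := by
      have := hM.eigenvectorBasis.inner_eq_one i
      rwa [EuclideanSpace.inner_eq_star_dotProduct, dotProduct_comm] at this
    rw [Matrix.sub_mulVec, Matrix.one_mulVec, h3, dotProduct_sub, dotProduct_smul, h4,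
      Complex.real_smul, mul_one, sub_nonneg] at h2
    exact_mod_cast h2
  have hlim : ∀ i, ∃ l : ℂ, Filter.Tendsto (fun D : ℕ => (hM.eigenvalues i : ℂ) ^ D)
      Filter.atTop (𝓝 l) := fun i => by
    by_cases h : hM.eigenvalues i = 1
    · exact ⟨1, by simp [h]⟩
    · refine ⟨0, tendsto_pow_atTop_nhds_zero_of_norm_lt_one ?_⟩
      rw [Complex.norm_real, Real.norm_of_nonneg (h0.eigenvalues_nonneg i)]
      exact lt_of_le_of_ne (hle i) h
  choose l hl using hlim
  refine ⟨φ (Matrix.diagonal l), ?_⟩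
  have hpow : ∀ D : ℕ, M ^ D = φ (Matrix.diagonal fun i => (hM.eigenvalues i : ℂ) ^ D) :=
    fun D => by
      conv_lhs => rw [hM.spectral_theorem, ← hφ, ← map_pow, Matrix.diagonal_pow]
      rfl
  simp only [hpow]
  refine (hcont.tendsto _).comp ?_
  refine (Continuous.matrix_diagonal continuous_id).tendsto _ |>.comp ?_
  exact tendsto_pi_nhds.mpr hl

/-- The powers of a convex combination of orthogonal projections converge to an orthogonal
projection `P` below all of them as soon as `P` fixes all common fixed vectors. -/
theorem tendsto_pow_convex_combination {J : Type} {s : Finset J} {p : J → ℝ}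
    (hp : ∀ j ∈ s, 0 < p j) (hsum : ∑ j ∈ s, p j = 1) {P : J → Matrix κ κ ℂ}
    (h1 : ∀ j, (P j).IsHermitian) (h2 : ∀ j, P j * P j = P j) {R : Matrix κ κ ℂ}
    (hR : R.IsHermitian) (hPR : ∀ j ∈ s, P j * R = R)
    (hfix : ∀ v : κ → ℂ, (∀ j ∈ s, P j *ᵥ v = v) → R *ᵥ v = v) :
    Filter.Tendsto (fun D : ℕ => (∑ j ∈ s, (p j : ℂ) • P j) ^ D) Filter.atTop (𝓝 R) := by
  set M := ∑ j ∈ s, (p j : ℂ) • P j with hMdef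
  have hp' : ∀ j ∈ s, (0 : ℂ) ≤ p j := fun j hj => Complex.zero_le_real.mpr (hp j hj).le
  have hM0 : M.PosSemidef := Matrix.posSemidef_sum _ fun j hj =>
    (posSemidef_of_projection (h1 j) (h2 j)).smul (hp' j hj)
  have hM1 : (1 - M).PosSemidef := by
    have : 1 - M = ∑ j ∈ s, (p j : ℂ) • (1 - P j) := by
      simp only [smul_sub, Finset.sum_sub_distrib]
      rw [← Finset.sum_smul, ← Complex.ofReal_sum, hsum, Complex.ofReal_one, one_smul]
    rw [this]
    exact Matrix.posSemidef_sum _ fun j hj =>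
      (posSemidef_one_sub_of_projection (h1 j) (h2 j)).smul (hp' j hj)
  obtain ⟨Q, hQ⟩ := tendsto_pow_of_posSemidef hM0 hM1
  have hMQ : M * Q = Q := by
    refine tendsto_nhds_unique ?_ (hQ.comp (Filter.tendsto_add_atTop_nat 1))
    have := (continuous_const_mul M).tendsto Q |>.comp hQ
    simpa only [Function.comp_def, pow_succ'] using this
  -- The columns of `Q` are fixed by `M`, hence by every `P j`, hence by `R`.
  have hRQ : R * Q = Q := by
    refine Matrix.ext_of_mulVec_single fun c => ?_
    rw [← Matrix.mulVec_mulVec]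
    refine hfix _ fun j hj => mulVec_eq_self_of_convex_combination hp hsum h1 h2 ?_ hj
    rw [Matrix.mulVec_mulVec, ← hMdef, hMQ]
  have hMR : M * R = R := by
    rw [hMdef, Finset.sum_mul, Finset.sum_congr rfl fun j hj => by rw [smul_mul_assoc, hPR j hj],
      ← Finset.sum_smul, ← Complex.ofReal_sum, hsum, Complex.ofReal_one, one_smul]
  have hpowR : ∀ D : ℕ, M ^ D * R = R := fun D => by
    induction D with
    | zero => simp
    | succ D ih => rw [pow_succ, mul_assoc, hMR, ih]
  have hQR : Q * R = R := by
    have := (continuous_mul_const R).tendsto Q |>.comp hQ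
    simp only [Function.comp_def, hpowR] at this
    exact tendsto_nhds_unique this tendsto_const_nhds
  have hQH : Q.IsHermitian := by
    have := (continuous_id.matrix_conjTranspose).tendsto Q |>.comp hQ
    simp only [Function.comp_def, id, Matrix.conjTranspose_pow, hM0.1.eq] at this
    exact tendsto_nhds_unique this hQ
  -- The adjoint of `R * Q = Q` is `Q * R = Q`, while `Q * R = R`.
  have : Q = R := by
    have h := congrArg Matrix.conjTranspose hRQ
    rw [Matrix.conjTranspose_mul, hQH.eq, hR.eq, hQR] at h
    exact h.symm
  rwa [← this]

end Projections

/-! ## The moment representation -/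

section Moment

variable {ι : Type} [Fintype ι]

theorem map_star_mul (A B : Matrix ι ι ℂ) : (A * B).map star = A.map star * B.map star := by
  ext a b
  simp [Matrix.mul_apply]

variable [DecidableEq ι]

/-- The representation `U ↦ U^{⊗ t} ⊗ (U^*)^{⊗ t}` of the unitary group. -/
def momentRep (ι : Type) [Fintype ι] [DecidableEq ι] (t : ℕ) :
    Matrix.unitaryGroup ι ℂ →* Matrix ((Fin t → ι) × (Fin t → ι)) ((Fin t → ι) × (Fin t → ι)) ℂ where
  toFun U := tensorPow t (U : Matrix ι ι ℂ) ⊗ₖ tensorPow t ((U : Matrix ι ι ℂ).map star)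
  map_one' := by
    simp [tensorPow_one]
  map_mul' U V := by
    rw [Submonoid.coe_mul, map_star_mul, tensorPow_mul, tensorPow_mul, Matrix.mul_kronecker_mul]

theorem momentRep_apply (t : ℕ) (U : Matrix.unitaryGroup ι ℂ) (a b) :
    momentRep ι t U a b = (∏ i, (U : Matrix ι ι ℂ) (a.1 i) (b.1 i)) *
      ∏ i, star ((U : Matrix ι ι ℂ) (a.2 i) (b.2 i)) := rfl

theorem continuous_momentRep (t : ℕ) : Continuous (momentRep ι t) := by
  refine continuous_pi fun a => continuous_pi fun b => ?_
  simp only [momentRep_apply]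
  exact (continuous_finsetProd _ fun i _ => continuous_subtype_val.matrix_elem _ _).mul
    (continuous_finsetProd _ fun i _ => (continuous_subtype_val.matrix_elem _ _).star)

theorem momentRep_inv (t : ℕ) (U : Matrix.unitaryGroup ι ℂ) :
    momentRep ι t U⁻¹ = (momentRep ι t U)ᴴ := by
  ext a b
  simp [momentRep_apply, Matrix.conjTranspose_apply, Matrix.star_apply]

/-- Vectorization turns the action into conjugation of `T` by the unitary `U^{⊗t}`. -/
theorem momentRep_mulVec_eq_self_iff (t : ℕ) (U : Matrix.unitaryGroup ι ℂ)
    (T : Matrix (Fin t → ι) (Fin t → ι) ℂ) :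
    momentRep ι t U *ᵥ (fun a => T a.1 a.2) = (fun a => T a.1 a.2) ↔
      Commute T (tensorPow t (U : Matrix ι ι ℂ)) := by
  have hA := tensorPow_mem_unitaryGroup t U.2
  have hB : tensorPow t ((U : Matrix ι ι ℂ).map star) =
      (star (tensorPow t (U : Matrix ι ι ℂ)))ᵀ := by
    rw [tensorPow_star]; rfl
  have hv : (fun a : (Fin t → ι) × (Fin t → ι) => T a.1 a.2) = Tᵀ.vec := rfl
  change (tensorPow t (U : Matrix ι ι ℂ) ⊗ₖ tensorPow t ((U : Matrix ι ι ℂ).map star)) *ᵥ _ = _ ↔ _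
  rw [hv, Matrix.kronecker_mulVec_vec, Matrix.vec_inj, hB, ← Matrix.transpose_mul,
    ← Matrix.transpose_mul, Matrix.transpose_inj, ← mul_assoc]
  constructor
  · intro h
    have h' := congrArg (· * tensorPow t (U : Matrix ι ι ℂ)) h
    simp only [mul_assoc, Matrix.mem_unitaryGroup_iff'.mp hA, mul_one] at h'
    exact h'.symm
  · intro h
    rw [← h.eq, mul_assoc, Matrix.mem_unitaryGroup_iff.mp hA, mul_one]

theorem momentOp_haarProb {G : Type} [Group G] (R : G →* Matrix.unitaryGroup ι ℂ) (t : ℕ) :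
    momentOp R t (haarProb (symUnitary R)) =
      haarAvg ((momentRep ι t).comp (symUnitary R).subtype) := rfl

end Moment

/-! ### The design property in terms of fixed vectors and commutants -/

section Circuit

variable {n : ℕ} {G : Type} [Group G] (R : G →* Matrix.unitaryGroup (Fin n → Fin 2) ℂ) (t : ℕ)

/-- The moment representation on the local symmetric unitaries. -/
def localMomentRep (γ : Finset (Fin n)) : localSymUnitary R γ →*
    Matrix ((Fin t → Fin n → Fin 2) × (Fin t → Fin n → Fin 2))
      ((Fin t → Fin n → Fin 2) × (Fin t → Fin n → Fin 2)) ℂ :=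
  (momentRep (Fin n → Fin 2) t).comp ((symUnitary R).subtype.comp (localSymUnitary R γ).subtype)

theorem continuous_localMomentRep (γ : Finset (Fin n)) : Continuous (localMomentRep R t γ) :=
  (continuous_momentRep t).comp (continuous_subtype_val.comp continuous_subtype_val)

theorem momentOp_circuitDist (Γ : Finset (Finset (Fin n))) {p : Finset (Fin n) → ℝ}
    (hp : ∀ γ ∈ Γ, 0 < p γ) :
    momentOp R t (circuitDist R Γ p) =
      ∑ γ ∈ Γ, (p γ : ℂ) • haarAvg (localMomentRep R t γ) := by
  ext a b
  have hc : Continuous fun U : symUnitary R => momentRep (Fin n → Fin 2) t U a b :=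
    ((continuous_momentRep t).comp continuous_subtype_val).matrix_elem a b
  have hmap : ∀ γ, ∫ U, momentRep (Fin n → Fin 2) t U a b
      ∂((haarProb (localSymUnitary R γ)).map (Subtype.val : localSymUnitary R γ → symUnitary R)) =
      haarAvg (localMomentRep R t γ) a b := fun γ =>
    MeasureTheory.integral_map continuous_subtype_val.measurable.aemeasurable
      hc.aestronglyMeasurable
  change ∫ U : symUnitary R, momentRep (Fin n → Fin 2) t U a b ∂(circuitDist R Γ p) = _
  rw [circuitDist, MeasureTheory.integral_finsetSum_measure]
  · simp only [MeasureTheory.integral_smul_measure, hmap, Matrix.sum_apply, Matrix.smul_apply]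
    refine Finset.sum_congr rfl fun γ hγ => ?_
    rw [ENNReal.toReal_ofReal (hp γ hγ).le]
    rfl
  · intro γ _
    have : MeasureTheory.IsProbabilityMeasure ((haarProb (localSymUnitary R γ)).map
        (Subtype.val : localSymUnitary R γ → symUnitary R)) :=
      MeasureTheory.Measure.isProbabilityMeasure_map
        continuous_subtype_val.measurable.aemeasurable
    exact (hc.integrable_of_hasCompactSupport (HasCompactSupport.of_compactSpace _)).smul_measure
      ENNReal.ofReal_ne_top

variable {R t}

theorem isAsymptoticSymmetricDesign_of_commute {Γ : Finset (Finset (Fin n))}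
    {p : Finset (Fin n) → ℝ} (hp : ∀ γ ∈ Γ, 0 < p γ) (hsum : ∑ γ ∈ Γ, p γ = 1)
    (h : ∀ T : Matrix (Fin t → Fin n → Fin 2) (Fin t → Fin n → Fin 2) ℂ,
      (∀ γ ∈ Γ, ∀ U : localSymUnitary R γ, Commute T (tensorPow t U.1.1.1)) →
      ∀ U : symUnitary R, Commute T (tensorPow t U.1.1)) :
    IsAsymptoticSymmetricDesign R t (circuitDist R Γ p) := by
  have hK : Continuous ((momentRep (Fin n → Fin 2) t).comp (symUnitary R).subtype) :=
    (continuous_momentRep t).comp continuous_subtype_val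
  have hinv : ∀ γ, ∀ U : localSymUnitary R γ,
      localMomentRep R t γ U⁻¹ = (localMomentRep R t γ U)ᴴ :=
    fun γ U => momentRep_inv t U.1.1
  rw [IsAsymptoticSymmetricDesign, momentOp_circuitDist R t Γ hp, momentOp_haarProb]
  refine tendsto_pow_convex_combination hp hsum
    (fun γ => haarAvg_isHermitian (continuous_localMomentRep R t γ) (hinv γ))
    (fun γ => haarAvg_mul_self (continuous_localMomentRep R t γ) (hinv γ))
    (haarAvg_isHermitian hK fun U => momentRep_inv t U.1) ?_ ?_
  · intro γ _
    refine Matrix.ext_of_mulVec_single fun c => ?_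
    rw [← Matrix.mulVec_mulVec]
    refine haarAvg_mulVec (continuous_localMomentRep R t γ) fun U => ?_
    rw [Matrix.mulVec_mulVec]
    congr 1
    exact mul_haarAvg hK U.1
  · intro v hv
    refine haarAvg_mulVec hK fun U => ?_
    refine (momentRep_mulVec_eq_self_iff t U.1 (Matrix.of fun a b => v (a, b))).mpr
      (h _ (fun γ hγ W => ?_) U)
    refine (momentRep_mulVec_eq_self_iff t W.1.1 (Matrix.of fun a b => v (a, b))).mp ?_
    change localMomentRep R t γ W *ᵥ v = v
    -- The vector `v` is its own average over the gates on `γ`, and the average absorbs `W`.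
    conv_lhs => rw [← hv γ hγ]
    rw [Matrix.mulVec_mulVec, mul_haarAvg (continuous_localMomentRep R t γ), hv γ hγ]

/-- All powers of the circuit's moment operator fix `v`, so their limit, the global Haar average,
does too; that average absorbs `U`. -/
theorem momentRep_mulVec_eq_self_of_design {Γ : Finset (Finset (Fin n))}
    {p : Finset (Fin n) → ℝ} (hp : ∀ γ ∈ Γ, 0 < p γ) (hsum : ∑ γ ∈ Γ, p γ = 1)
    (h : IsAsymptoticSymmetricDesign R t (circuitDist R Γ p))
    {v : (Fin t → Fin n → Fin 2) × (Fin t → Fin n → Fin 2) → ℂ}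
    (hv : ∀ γ ∈ Γ, ∀ U : localSymUnitary R γ, momentRep (Fin n → Fin 2) t U.1.1 *ᵥ v = v)
    (U : symUnitary R) : momentRep (Fin n → Fin 2) t U.1 *ᵥ v = v := by
  have hK : Continuous ((momentRep (Fin n → Fin 2) t).comp (symUnitary R).subtype) :=
    (continuous_momentRep t).comp continuous_subtype_val
  rw [IsAsymptoticSymmetricDesign, momentOp_circuitDist R t Γ hp, momentOp_haarProb] at h
  set M := ∑ γ ∈ Γ, (p γ : ℂ) • haarAvg (localMomentRep R t γ) with hM
  have hMv : M *ᵥ v = v := by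
    rw [hM, Matrix.sum_mulVec, Finset.sum_congr rfl fun γ hγ => by
      rw [Matrix.smul_mulVec, haarAvg_mulVec (continuous_localMomentRep R t γ) (hv γ hγ)],
      ← Finset.sum_smul, ← Complex.ofReal_sum, hsum, Complex.ofReal_one, one_smul]
  have hpow : ∀ D : ℕ, M ^ D *ᵥ v = v := fun D => by
    induction D with
    | zero => simp
    | succ D ih => rw [pow_succ, ← Matrix.mulVec_mulVec, hMv, ih]
  have hcont : Continuous fun A : Matrix ((Fin t → Fin n → Fin 2) × (Fin t → Fin n → Fin 2))
      ((Fin t → Fin n → Fin 2) × (Fin t → Fin n → Fin 2)) ℂ => A *ᵥ v :=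
    continuous_id.matrix_mulVec continuous_const
  have hlim := (hcont.tendsto _).comp h
  simp only [Function.comp_def, hpow] at hlim
  conv_lhs => rw [tendsto_nhds_unique tendsto_const_nhds hlim]
  rw [Matrix.mulVec_mulVec]
  exact (congrArg (· *ᵥ v) (mul_haarAvg hK U)).trans (tendsto_nhds_unique hlim tendsto_const_nhds)

end Circuit

/-! ## Characters of bit strings -/

/-- The sign `(-1)^{ab}` of two bits. -/
def bitSign (a b : Fin 2) : ℂ := if a = 1 ∧ b = 1 then -1 else 1

theorem bitSign_add (a b c : Fin 2) : bitSign a (b + c) = bitSign a b * bitSign a c := by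
  fin_cases a <;> fin_cases b <;> fin_cases c <;> simp [bitSign]

theorem bitSign_comm (a b : Fin 2) : bitSign a b = bitSign b a := by
  simp [bitSign, and_comm]

theorem bitSign_mul_self (a b : Fin 2) : bitSign a b * bitSign a b = 1 := by
  unfold bitSign; split_ifs <;> norm_num

theorem bitSign_zero_right (a : Fin 2) : bitSign a 0 = 1 := by simp [bitSign]

theorem bit_add_self (a : Fin 2) : a + a = 0 := by fin_cases a <;> rfl

theorem pauliZ_apply_self (a : Fin 2) : pauliZ a a = bitSign 1 a := by
  fin_cases a <;> simp [pauliZ, bitSign]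

section Characters

variable {q : Type}

theorem string_add_self (x : q → Fin 2) : x + x = 0 := funext fun i => bit_add_self (x i)

theorem string_add_eq_zero_iff {x y : q → Fin 2} : x + y = 0 ↔ x = y := by
  refine ⟨fun h => ?_, fun h => h ▸ string_add_self x⟩
  rw [← add_zero x, ← string_add_self y, ← add_assoc, h, zero_add]

variable [Fintype q]

/-- The sign `(-1)^{b · x}` of two bit strings. -/
def sgn (b x : q → Fin 2) : ℂ := ∏ i, bitSign (b i) (x i)

theorem sgn_add_right (b x y : q → Fin 2) : sgn b (x + y) = sgn b x * sgn b y := by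
  simp only [sgn, Pi.add_apply, bitSign_add, Finset.prod_mul_distrib]

theorem sgn_comm (b x : q → Fin 2) : sgn b x = sgn x b := by
  simp only [sgn, bitSign_comm]

theorem sgn_add_left (a b x : q → Fin 2) : sgn (a + b) x = sgn a x * sgn b x := by
  rw [sgn_comm, sgn_add_right, sgn_comm x a, sgn_comm x b]

theorem sgn_mul_self (b x : q → Fin 2) : sgn b x * sgn b x = 1 := by
  simp only [sgn, ← Finset.prod_mul_distrib, bitSign_mul_self, Finset.prod_const_one]

theorem sgn_zero_right (b : q → Fin 2) : sgn b 0 = 1 := by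
  simp [sgn, bitSign_zero_right]

theorem sgn_zero_left (b : q → Fin 2) : sgn 0 b = 1 := by
  rw [sgn_comm, sgn_zero_right]

theorem sgn_eq_or (b x : q → Fin 2) : sgn b x = 1 ∨ sgn b x = -1 :=
  mul_self_eq_one_iff.mp (sgn_mul_self b x)

theorem star_sgn (b x : q → Fin 2) : star (sgn b x) = sgn b x := by
  rcases sgn_eq_or b x with h | h <;> simp [h]

/-! ## Pauli operators -/

/-- The Pauli operator `X^a Z^b`. -/
def pauli (a b : q → Fin 2) : Matrix (q → Fin 2) (q → Fin 2) ℂ :=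
  Matrix.of fun x y => if x = y + a then sgn b y else 0

theorem pauli_zero_zero : pauli (0 : q → Fin 2) 0 = 1 := by
  ext x y
  simp [pauli, sgn_zero_left, Matrix.one_apply]

theorem pauli_zero_left (b : q → Fin 2) : pauli 0 b = Matrix.diagonal (sgn b) := by
  ext x y
  by_cases h : x = y
  · simp [pauli, h]
  · simp [pauli, h]

/-- Exchanging `X^a` and `Z^b` costs the sign `sgn a b`, and `pauli` carries no compensating phase.
-/
theorem star_pauli (a b : q → Fin 2) (h : sgn a b = 1) : star (pauli a b) = pauli a b := by
  ext x y
  have hs : ∀ z, sgn b (z + a) = sgn b z := fun z => by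
    rw [sgn_add_right, sgn_comm b a, h, mul_one]
  by_cases hxy : x = y + a
  · have : y = x + a := by rw [hxy, add_assoc, string_add_self, add_zero]
    simp only [Matrix.star_apply, pauli, Matrix.of_apply, if_pos hxy, if_pos this, star_sgn]
    rw [hxy, hs]
  · have : y ≠ x + a := by
      rintro rfl
      exact hxy (by rw [add_assoc, string_add_self, add_zero])
    simp [Matrix.star_apply, pauli, hxy, this]

variable [DecidableEq q]

theorem pauli_mul (a b c d : q → Fin 2) :
    pauli a b * pauli c d = sgn b c • pauli (a + c) (b + d) := by
  ext x y
  rw [Matrix.mul_apply, Finset.sum_eq_single (y + c)]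
  · simp only [pauli, Matrix.of_apply, Matrix.smul_apply, smul_eq_mul, if_true, ite_mul, zero_mul,
      mul_ite, mul_zero, add_assoc, add_comm c a, sgn_add_right, sgn_add_left]
    split_ifs <;> ring
  · intro z _ hz
    simp [pauli, hz]
  · simp

theorem pauli_commutator (a b c d : q → Fin 2) :
    pauli a b * pauli c d - pauli c d * pauli a b =
      (sgn b c - sgn d a) • pauli (a + c) (b + d) := by
  rw [pauli_mul, pauli_mul, add_comm c a, add_comm d b, sub_smul]

theorem pauli_mul_self (a b : q → Fin 2) (h : sgn a b = 1) : pauli a b * pauli a b = 1 := by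
  rw [pauli_mul, sgn_comm, h, one_smul, string_add_self, string_add_self, pauli_zero_zero]

theorem sgn_single_left (i : q) (x : q → Fin 2) : sgn (Pi.single i 1) x = bitSign 1 (x i) := by
  rw [sgn, Finset.prod_eq_single i]
  · simp
  · intro j _ hj
    simp [Pi.single_eq_of_ne hj, bitSign]
  · simp

theorem sum_sgn (x : q → Fin 2) :
    ∑ b : q → Fin 2, sgn b x = if x = 0 then (2 : ℂ) ^ Fintype.card q else 0 := by
  split_ifs with h
  · subst h
    simp [sgn_zero_right]
  · obtain ⟨i, hi⟩ := Function.ne_iff.mp h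
    have hi1 : x i = 1 := by
      have : x i ≠ 0 := hi
      omega
    have h1 : ∑ b : q → Fin 2, sgn b x = ∑ b : q → Fin 2, sgn (b + Pi.single i 1) x :=
      (Equiv.sum_comp (Equiv.addRight (Pi.single i 1)) fun b : q → Fin 2 => sgn b x).symm
    have h2 : bitSign 1 1 = -1 := by simp [bitSign]
    simp only [sgn_add_left, sgn_single_left, hi1, h2, mul_neg, mul_one,
      Finset.sum_neg_distrib] at h1
    exact self_eq_neg.mp h1

/-- Fourier inversion: the sum over `Z^b` projects onto the string `y`, which `X^(x+y)` carries to
`x`. Thus Pauli operators span the matrix units. -/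
theorem sum_sgn_smul_pauli (x y : q → Fin 2) :
    ∑ b : q → Fin 2, sgn b y • pauli (x + y) b =
      (2 : ℂ) ^ Fintype.card q • Matrix.single x y 1 := by
  ext z w
  simp only [Matrix.sum_apply, Matrix.smul_apply, smul_eq_mul, pauli, Matrix.of_apply, mul_ite,
    mul_zero, ← sgn_add_right]
  by_cases hw : y = w
  · subst hw
    have : y + (x + y) = x := by rw [add_comm x, ← add_assoc, string_add_self, zero_add]
    rw [this]
    by_cases hz : z = x
    · subst hz
      simp [string_add_self, sgn_zero_right]
    · simp [hz, Ne.symm hz]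
  · have h0 : y + w ≠ 0 := fun h => hw (string_add_eq_zero_iff.mp h)
    rw [Matrix.single_apply_of_ne (h := fun h => hw h.2), mul_zero]
    split_ifs
    · rw [sum_sgn, if_neg h0]
    · simp

end Characters

/-! ## The Lie closure of two-qubit Pauli operators -/

section Closure

variable {q : Type} [Fintype q] [DecidableEq q]

/-- A set of Pauli labels closed under commutators. -/
def CommutatorClosed (L : (q → Fin 2) → (q → Fin 2) → Prop) : Prop :=
  ∀ a b c d, L a b → L c d → sgn b c * sgn d a = -1 → L (a + c) (b + d)

theorem sgn_single_single (i j : q) :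
    sgn (Pi.single i 1) (Pi.single j 1) = if i = j then -1 else 1 := by
  rw [sgn_single_left]
  by_cases h : i = j
  · subst h; simp [bitSign]
  · simp [bitSign, h]

variable {L : (q → Fin 2) → (q → Fin 2) → Prop}

theorem CommutatorClosed.flip_single (hL : CommutatorClosed L)
    (hz : ∀ i, L 0 (Pi.single i 1)) {a b : q → Fin 2} {i : q} (hi : a i = 1) (h : L a b) :
    L a (b + Pi.single i 1) := by
  have := hL a b 0 (Pi.single i 1) h (hz i) (by
    rw [sgn_zero_right, sgn_single_left, hi]; simp [bitSign])
  rwa [add_zero] at this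

/-- The qubits `i` and `j` are coupled by `XX` and `ZZ` terms. -/
def Coupled (L : (q → Fin 2) → (q → Fin 2) → Prop) (i j : q) : Prop :=
  L (Pi.single i 1 + Pi.single j 1) 0 ∧ L 0 (Pi.single i 1 + Pi.single j 1)

/-- Up to phases, with `Y = XZ`, the first chain is `X_i X_j → X_i Y_j → X_i Z_j X_k → X_i Y_k → X_i
X_k`, by commutators with `Z_j`, `X_j X_k`, `Z_j Z_k`, `Z_k`. The second is `X_i Y_j → Y_i Y_j → Y_i
X_j Z_k → Z_i Z_k`, by `Z_i`, `Z_j Z_k`, `X_i X_j`. -/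
theorem CommutatorClosed.coupled_trans (hL : CommutatorClosed L)
    (hz : ∀ i, L 0 (Pi.single i 1)) {i j k : q} (hij : i ≠ j) (hjk : j ≠ k) (hik : i ≠ k)
    (h1 : Coupled L i j) (h2 : Coupled L j k) : Coupled L i k := by
  have e2 : ∀ x : q → Fin 2, ∀ i : q, x + Pi.single i 1 + Pi.single i 1 = x := fun x i => by
    rw [add_assoc, string_add_self, add_zero]
  set e : q → (q → Fin 2) := fun i => Pi.single i 1 with he
  have ee : ∀ i, e i + e i = 0 := fun i => string_add_self _
  have hii : ∀ i, sgn (e i) (e i) = -1 := fun i => by simp [he, sgn_single_single]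
  have hne : ∀ {i j}, i ≠ j → sgn (e i) (e j) = 1 := fun h => by simp [he, sgn_single_single, h]
  have a1 : L (e i + e j) (e j) := by
    have := hL.flip_single hz (i := j) (by simp [hij]) h1.1
    rwa [zero_add] at this
  have a2 : L (e i + e k) (e j) := by
    have := hL _ _ _ _ a1 h2.1 (by
      rw [sgn_zero_left, sgn_add_right, hii, hne hjk]; norm_num)
    rwa [add_zero, add_assoc, ← add_assoc (e j), ee, zero_add] at this
  have a3 : L (e i + e k) (e k) := by
    have := hL _ _ _ _ a2 h2.2 (by
      rw [sgn_zero_right, sgn_add_right, sgn_add_left, sgn_add_left, hii, hne hjk, hne hij.symm,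
        hne hik.symm]; norm_num)
    rwa [add_zero, ← add_assoc, ee, zero_add] at this
  have b1 : L (e i + e j) (e i + e j) := by
    have := hL.flip_single hz (i := i) (by simp [he, hij]) a1
    rwa [add_comm (e j)] at this
  have b2 : L (e i + e j) (e i + e k) := by
    have := hL _ _ _ _ b1 h2.2 (by
      rw [sgn_zero_right, sgn_add_right, sgn_add_left, sgn_add_left, hii, hne hjk.symm,
        hne hij.symm, hne hik.symm]; norm_num)
    rwa [add_zero, add_assoc, ← add_assoc (e j), ee, zero_add] at this
  refine ⟨?_, ?_⟩
  · have := hL.flip_single hz (i := k) (by simp [he, hik.symm]) a3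
    rwa [string_add_self] at this
  · have := hL _ _ _ _ h1.1 b2 (by
      rw [sgn_zero_left, sgn_add_right, sgn_add_left, sgn_add_left, hii, hne hij, hne hik.symm,
        hne hjk.symm]; norm_num)
    rwa [string_add_self, zero_add] at this

theorem bit_eq_zero_or_one (a : Fin 2) : a = 0 ∨ a = 1 := by omega

/-- A property of bit strings that survives flipping any bit holds for all bit strings. -/
theorem forall_of_flip {P : (q → Fin 2) → Prop} (hP : ∀ b i, P b → P (b + Pi.single i 1))
    {b₀ : q → Fin 2} (h₀ : P b₀) (b : q → Fin 2) : P b := by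
  have key : ∀ s : Finset q, P (b₀ + ∑ i ∈ s, Pi.single i (b i + b₀ i)) := fun s => by
    induction s using Finset.induction_on with
    | empty => simpa using h₀
    | insert i s hi ih =>
      rw [Finset.sum_insert hi, add_comm (Pi.single i _), ← add_assoc]
      rcases bit_eq_zero_or_one (b i + b₀ i) with h | h
      · rw [h, Pi.single_zero, add_zero]; exact ih
      · rw [h]; exact hP _ _ ih
  have := key Finset.univ
  rw [Finset.univ_sum_single] at this
  have hb : (b₀ + fun i => b i + b₀ i) = b := by
    change b₀ + (b + b₀) = b
    rw [add_comm b, ← add_assoc, string_add_self, zero_add]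
  rwa [hb] at this

/-- Let `a i = 1`. If `a m = 1`, a commutator with `Z_m` flips bit `m` of `b`. Otherwise `Z_i Z_m`
flips bits `i` and `m`, and `Z_i` restores bit `i`. -/
theorem CommutatorClosed.forall_right (hL : CommutatorClosed L)
    (hz : ∀ i, L 0 (Pi.single i 1))
    (hzz : ∀ i j, i ≠ j → L 0 (Pi.single i 1 + Pi.single j 1)) {a b₀ : q → Fin 2} (ha : a ≠ 0)
    (h : L a b₀) (b : q → Fin 2) : L a b := by
  refine forall_of_flip (fun b m hb => ?_) h b
  obtain ⟨i, hi⟩ := Function.ne_iff.mp ha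
  have hi1 : a i = 1 := (bit_eq_zero_or_one (a i)).resolve_left hi
  rcases bit_eq_zero_or_one (a m) with hm | hm
  · have him : i ≠ m := by rintro rfl; simp [hi1] at hm
    have := hL _ _ _ _ hb (hzz i m him) (by
      rw [sgn_zero_right, sgn_add_left, sgn_single_left, sgn_single_left, hi1, hm]; simp [bitSign])
    have := hL.flip_single hz (i := i) (by simpa using hi1) this
    have e : b + (Pi.single i 1 + Pi.single m 1) + Pi.single i 1 = b + Pi.single m 1 := by
      rw [add_comm (Pi.single i 1) (Pi.single m 1), ← add_assoc, add_assoc _ (Pi.single i 1),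
        string_add_self, add_zero]
    rwa [add_zero, e] at this
  · exact hL.flip_single hz hm hb

theorem CommutatorClosed.single_add_single (hL : CommutatorClosed L)
    (hz : ∀ i, L 0 (Pi.single i 1)) (hc : ∀ i j, i ≠ j → Coupled L i j) {i j : q} (hij : i ≠ j)
    (b : q → Fin 2) : L (Pi.single i 1 + Pi.single j 1) b := by
  refine hL.forall_right hz (fun i j h => (hc i j h).2) (fun h => ?_) (hc i j hij).1 b
  have := congrFun h i
  simp [hij] at this

/-- Induction on the weight of `a`: even parity provides two positions to remove at once, and `X_i
X_j` puts them back. -/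
theorem CommutatorClosed.even_of_ne_zero (hL : CommutatorClosed L)
    (hz : ∀ i, L 0 (Pi.single i 1)) (hc : ∀ i j, i ≠ j → Coupled L i j) :
    ∀ (m : ℕ) (a : q → Fin 2), (Finset.univ.filter fun i => a i = 1).card = m → sgn 1 a = 1 →
      a ≠ 0 → ∀ b, L a b := by
  intro m
  induction m using Nat.strong_induction_on with
  | _ m ih =>
    intro a hm ha ha0 b
    obtain ⟨i, hi⟩ := Function.ne_iff.mp ha0
    have hi1 : a i = 1 := (bit_eq_zero_or_one (a i)).resolve_left hi
    have hone : ∀ i : q, sgn 1 (Pi.single i 1 : q → Fin 2) = -1 := fun i => by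
      rw [sgn_comm, sgn_single_left]; simp [bitSign]
    have hex : ∃ j, i ≠ j ∧ a j = 1 := by
      by_contra! hcon
      have : a = Pi.single i 1 := by
        ext1 j
        by_cases hj : i = j
        · subst hj; simp [hi1]
        · rw [Pi.single_eq_of_ne (Ne.symm hj)]
          exact (bit_eq_zero_or_one (a j)).resolve_right (hcon j hj)
      rw [this, hone] at ha
      norm_num at ha
    obtain ⟨j, hij, hj1⟩ := hex
    set a' := a + (Pi.single i 1 + Pi.single j 1) with ha'
    have haa : a = a' + (Pi.single i 1 + Pi.single j 1) := by
      rw [ha', add_assoc, string_add_self, add_zero]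
    by_cases h0 : a' = 0
    · rw [haa, h0, zero_add]
      exact hL.single_add_single hz hc hij b
    · have hi' : a' i = 0 := by simp [ha', hi1, hij]
      have hlt : (Finset.univ.filter fun i => a' i = 1).card < m := by
        rw [← hm]
        refine Finset.card_lt_card (Finset.ssubset_iff_of_subset (fun k hk => ?_) |>.mpr
          ⟨i, by simp [hi1], by simp [hi']⟩)
        simp only [Finset.mem_filter, Finset.mem_univ, true_and] at hk ⊢
        by_cases hki : k = i
        · rw [hki, hi1]
        by_cases hkj : k = j
        · rw [hkj, hj1]
        simpa [ha', Pi.single_eq_of_ne hki, Pi.single_eq_of_ne hkj] using hk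
      have hs : sgn 1 a' = 1 := by
        rw [ha', sgn_add_right, sgn_add_right, hone, hone, ha]; norm_num
      -- The factor `Z_i` is chosen so that `X^a' Z_i` anticommutes with `X_i X_j`.
      have h3 := ih _ hlt a' rfl hs h0 (Pi.single i 1)
      have h4 := hL.single_add_single hz hc hij 0
      have h5 := hL _ _ _ _ h3 h4 (by
        rw [sgn_zero_left, sgn_add_right, sgn_single_single, sgn_single_single]; simp [hij])
      rw [← haa] at h5
      exact hL.forall_right hz (fun i j h => (hc i j h).2) ha0 h5 b

/-- For `a = 0` and nonconstant `b`, choose `i`, `j` with `b i = 1`, `b j = 0`: then `X_i X_j` and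
`X_i X_j Z^b` anticommute and multiply to `Z^b` up to sign. The excluded `Z^{⊗n}` commutes with all
even labels, so no such commutator produces it. -/
theorem CommutatorClosed.even (hL : CommutatorClosed L) (h00 : L 0 0)
    (hz : ∀ i, L 0 (Pi.single i 1)) (hc : ∀ i j, i ≠ j → Coupled L i j) {a : q → Fin 2}
    (ha : sgn 1 a = 1) (b : q → Fin 2) (hab : a ≠ 0 ∨ b ≠ 1) : L a b := by
  by_cases ha0 : a = 0
  · subst ha0
    have hb1 := hab.resolve_left (by simp)
    by_cases hb0 : b = 0
    · rwa [hb0]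
    obtain ⟨i, hi⟩ := Function.ne_iff.mp hb0
    obtain ⟨j, hj⟩ := Function.ne_iff.mp hb1
    have hi1 : b i = 1 := (bit_eq_zero_or_one (b i)).resolve_left hi
    have hj1 : b j = 0 := (bit_eq_zero_or_one (b j)).resolve_right hj
    have hij : i ≠ j := by rintro rfl; simp [hi1] at hj1
    have := hL _ _ _ _ (hL.single_add_single hz hc hij 0) (hL.single_add_single hz hc hij b) (by
      rw [sgn_zero_left, sgn_add_right, sgn_comm b, sgn_comm b, sgn_single_left, sgn_single_left,
        hi1, hj1]; simp [bitSign])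
    rwa [string_add_self, zero_add] at this
  · exact hL.even_of_ne_zero hz hc _ a rfl ha ha0 b

end Closure

/-! ## Symmetric unitaries and local Pauli rotations -/

section Symmetric

variable {n : ℕ}

theorem tensorPow_pauliZ : tensorPow n pauliZ = pauli 0 1 := by
  rw [pauli_zero_left]
  ext x y
  by_cases h : x = y
  · subst h
    simp [tensorPow, pauliZ_apply_self, sgn]
  · rw [Matrix.diagonal_apply_ne _ h]
    obtain ⟨i, hi⟩ := Function.ne_iff.mp h
    refine Finset.prod_eq_zero (Finset.mem_univ i) ?_
    generalize x i = u at *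
    generalize y i = w at *
    fin_cases u <;> fin_cases w <;> simp_all [pauliZ]

theorem mem_symUnitary_z2Rep_iff {U : Matrix.unitaryGroup (Fin n → Fin 2) ℂ} :
    U ∈ symUnitary (z2Rep n) ↔ Commute (U : Matrix (Fin n → Fin 2) (Fin n → Fin 2) ℂ)
      (pauli 0 1) := by
  have h : ∀ g, ((z2Rep n g : Matrix.unitaryGroup (Fin n → Fin 2) ℂ) :
      Matrix (Fin n → Fin 2) (Fin n → Fin 2) ℂ) =
      tensorPow n (pauliZ ^ (Multiplicative.toAdd g).val) := fun g => rfl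
  rw [symUnitary, Subgroup.mem_centralizer_iff]
  constructor
  · intro hU
    have := congrArg Subtype.val (hU _ ⟨Multiplicative.ofAdd 1, rfl⟩)
    rw [Submonoid.coe_mul, Submonoid.coe_mul, h, toAdd_ofAdd, ZMod.val_one, pow_one,
      tensorPow_pauliZ] at this
    exact this.symm
  · rintro hU _ ⟨g, rfl⟩
    refine Subtype.ext ?_
    rw [Submonoid.coe_mul, Submonoid.coe_mul, h]
    have hlt : (Multiplicative.toAdd g).val < 2 := ZMod.val_lt _
    interval_cases (Multiplicative.toAdd g).val
    · simp [tensorPow_one]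
    · rw [pow_one, tensorPow_pauliZ]
      exact hU.eq.symm

theorem commute_pauli_parity {a : Fin n → Fin 2} (ha : sgn 1 a = 1) (b : Fin n → Fin 2) :
    Commute (pauli a b) (pauli 0 1) := by
  rw [Commute, SemiconjBy, pauli_mul, pauli_mul, sgn_zero_right, ha, add_comm, add_comm b]

theorem commute_parity_apply {A : Matrix (Fin n → Fin 2) (Fin n → Fin 2) ℂ}
    (hA : Commute A (pauli 0 1)) {x y : Fin n → Fin 2} (h : sgn 1 x ≠ sgn 1 y) : A x y = 0 := by
  have := congrFun (congrFun hA.eq x) y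
  rw [pauli_zero_left, Matrix.mul_diagonal, Matrix.diagonal_mul, mul_comm] at this
  by_contra h0
  exact h (mul_right_cancel₀ h0 this).symm

theorem embedMatrix_pauli (γ : Finset (Fin n)) {a b : Fin n → Fin 2} (ha : ∀ i, i ∉ γ → a i = 0)
    (hb : ∀ i, i ∉ γ → b i = 0) :
    embedMatrix γ (pauli (fun i => a i) (fun i => b i)) = pauli a b := by
  ext x y
  have hs : sgn (fun i : {q // q ∈ γ} => b i) (fun i => y i) = sgn b y := by
    have h := Finset.prod_subset (Finset.subset_univ γ) (f := fun i => bitSign (b i) (y i))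
      fun i _ hi => by rw [hb i hi, bitSign_comm, bitSign_zero_right]
    rw [sgn, sgn, ← h]
    exact Finset.prod_coe_sort γ fun i => bitSign (b i) (y i)
  change pauli (fun i : {q // q ∈ γ} => a i) (fun i => b i) (fun i => x i) (fun i => y i) *
    (1 : Matrix ({q // q ∉ γ} → Fin 2) ({q // q ∉ γ} → Fin 2) ℂ) (fun i : {q // q ∉ γ} => x i)
      (fun i : {q // q ∉ γ} => y i) = _
  by_cases h : x = y + a
  · have h2 : (fun i : {q // q ∉ γ} => x i) = fun i : {q // q ∉ γ} => y i := by
      ext1 i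
      rw [h, Pi.add_apply, ha i i.2, add_zero]
    rw [h2, Matrix.one_apply_eq, mul_one]
    simp only [pauli, Matrix.of_apply, if_pos h, hs]
    rw [if_pos]
    ext1 i
    rw [h]; rfl
  · simp only [pauli, Matrix.of_apply, if_neg h, Matrix.one_apply]
    rw [mul_eq_zero, ite_eq_right_iff, ite_eq_right_iff]
    by_contra! hcon
    refine h (funext fun i => ?_)
    by_cases hi : i ∈ γ
    · exact congrFun hcon.1.1 ⟨i, hi⟩
    · rw [Pi.add_apply, ha i hi, add_zero]
      exact congrFun hcon.2.1 ⟨i, hi⟩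

/-- The rotation `exp(i s P)` generated by an involution `P`. -/
def rotation {ι : Type} [DecidableEq ι] (P : Matrix ι ι ℂ) (s : ℝ) : Matrix ι ι ℂ :=
  (Real.cos s : ℂ) • 1 + (Complex.I * Real.sin s) • P

theorem rotation_mem_unitaryGroup {ι : Type} [Fintype ι] [DecidableEq ι] {P : Matrix ι ι ℂ}
    (h1 : star P = P) (h2 : P * P = 1) (s : ℝ) :
    rotation P s ∈ Matrix.unitaryGroup ι ℂ := by
  rw [Matrix.mem_unitaryGroup_iff, rotation, star_add, star_smul, star_smul, star_one, h1]
  simp only [add_mul, mul_add, smul_mul_smul_comm, one_mul, mul_one, h2]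
  have h3 : (Real.cos s : ℂ) * star (Real.cos s : ℂ) +
      Complex.I * Real.sin s * star (Complex.I * Real.sin s : ℂ) = 1 := by
    have hcs : (Real.cos s : ℂ) ^ 2 + (Real.sin s : ℂ) ^ 2 = 1 := by
      exact_mod_cast Real.cos_sq_add_sin_sq s
    simp only [Complex.star_def, map_mul, Complex.conj_ofReal, Complex.conj_I]
    linear_combination hcs - (Real.sin s : ℂ) ^ 2 * Complex.I_sq
  have h4 : (Real.cos s : ℂ) * star (Complex.I * Real.sin s : ℂ) +
      Complex.I * Real.sin s * star (Real.cos s : ℂ) = 0 := by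
    simp only [Complex.star_def, map_mul, Complex.conj_ofReal, Complex.conj_I]
    ring
  calc _ = ((Real.cos s : ℂ) * star (Real.cos s : ℂ) +
      Complex.I * Real.sin s * star (Complex.I * Real.sin s : ℂ)) • (1 : Matrix ι ι ℂ) +
      ((Real.cos s : ℂ) * star (Complex.I * Real.sin s : ℂ) +
      Complex.I * Real.sin s * star (Real.cos s : ℂ)) • P := by
        simp only [add_smul]; abel
    _ = 1 := by rw [h3, h4, one_smul, zero_smul, add_zero]

theorem embedMatrix_rotation (γ : Finset (Fin n))
    (P : Matrix ({q // q ∈ γ} → Fin 2) ({q // q ∈ γ} → Fin 2) ℂ) (s : ℝ) :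
    embedMatrix γ (rotation P s) = rotation (embedMatrix γ P) s := by
  rw [rotation, rotation, ← embedMatrix_one γ]
  simp only [embedMatrix, Matrix.add_kronecker, Matrix.smul_kronecker, Matrix.submatrix_add,
    Matrix.submatrix_smul, Pi.add_apply, Pi.smul_apply]

/-! ### From local gates to commuting Pauli generators -/

variable {t : ℕ} {T : Matrix (Fin t → Fin n → Fin 2) (Fin t → Fin n → Fin 2) ℂ}

/-- Differentiate along the rotations `exp(i s P)`: `hab` makes `P` a self-adjoint involution on
`γ`, and `hpar` makes it symmetric. -/
theorem commute_lieAct_local_pauli {γ : Finset (Fin n)}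
    (hT : ∀ U : localSymUnitary (z2Rep n) γ, Commute T (tensorPow t U.1.1.1))
    {a b : Fin n → Fin 2} (ha : ∀ i, i ∉ γ → a i = 0) (hb : ∀ i, i ∉ γ → b i = 0)
    (hab : sgn (fun i : {q // q ∈ γ} => a i) (fun i => b i) = 1) (hpar : sgn 1 a = 1) :
    Commute T (lieAct t (pauli a b)) := by
  have key : Commute T (lieAct t (Complex.I • pauli a b)) := by
    refine commute_lieAct_of_curve (E := rotation (pauli a b)) (by simp [rotation])
      (fun x y => ?_) fun s => ?_
    · have h1 : HasDerivAt (fun s : ℝ => (Real.cos s : ℂ)) 0 0 := by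
        simpa using (Real.hasDerivAt_cos 0).ofReal_comp
      have h2 : HasDerivAt (fun s : ℝ => (Real.sin s : ℂ)) 1 0 := by
        simpa using (Real.hasDerivAt_sin 0).ofReal_comp
      have h3 := (h1.mul_const ((1 : Matrix (Fin n → Fin 2) (Fin n → Fin 2) ℂ) x y)).fun_add
        ((h2.const_mul Complex.I).mul_const (pauli a b x y))
      simpa [rotation] using h3
    · let V : Matrix.unitaryGroup ({q // q ∈ γ} → Fin 2) ℂ :=
        ⟨rotation (pauli (fun i => a i) (fun i => b i)) s,
          rotation_mem_unitaryGroup (star_pauli _ _ hab) (pauli_mul_self _ _ hab) s⟩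
      have hV : (embedUnitary γ V : Matrix (Fin n → Fin 2) (Fin n → Fin 2) ℂ) =
          rotation (pauli a b) s := by
        rw [← embedMatrix_pauli γ ha hb, ← embedMatrix_rotation]; rfl
      have hsym : embedUnitary γ V ∈ symUnitary (z2Rep n) := by
        rw [mem_symUnitary_z2Rep_iff, hV]
        exact ((Commute.one_left _).smul_left _).add_left
          ((commute_pauli_parity hpar b).smul_left _)
      have := hT ⟨⟨embedUnitary γ V, hsym⟩, V, rfl⟩
      rwa [← hV]
  rw [map_smul] at key
  have := key.smul_right (-Complex.I)
  rwa [smul_smul, neg_mul, Complex.I_mul_I, neg_neg, one_smul] at this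

theorem commute_lieAct_local_pauli_right {γ : Finset (Fin n)}
    (hT : ∀ U : localSymUnitary (z2Rep n) γ, Commute T (tensorPow t U.1.1.1))
    {b : Fin n → Fin 2} (hb : ∀ i, i ∉ γ → b i = 0) : Commute T (lieAct t (pauli 0 b)) :=
  commute_lieAct_local_pauli hT (fun i _ => Pi.zero_apply i) hb
    (Finset.prod_eq_one fun _ _ => (bitSign_comm _ _).trans (bitSign_zero_right _))
    (sgn_zero_right 1)

theorem commute_lieAct_local_pauli_left {γ : Finset (Fin n)}
    (hT : ∀ U : localSymUnitary (z2Rep n) γ, Commute T (tensorPow t U.1.1.1))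
    {a : Fin n → Fin 2} (ha : ∀ i, i ∉ γ → a i = 0) (hpar : sgn 1 a = 1) :
    Commute T (lieAct t (pauli a 0)) :=
  commute_lieAct_local_pauli hT ha (fun i _ => Pi.zero_apply i)
    (Finset.prod_eq_one fun _ _ => bitSign_zero_right _) hpar

/-- The Pauli labels whose action on the tensor power commutes with `T`. -/
def CommutingLabel (T : Matrix (Fin t → Fin n → Fin 2) (Fin t → Fin n → Fin 2) ℂ)
    (a b : Fin n → Fin 2) : Prop :=
  Commute T (lieAct t (pauli a b))

/-- The derived action respects brackets, and for anticommuting labels the coefficient of the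
bracket is `±2`. -/
theorem commutatorClosed_commutingLabel : CommutatorClosed (CommutingLabel T) := by
  intro a b c d h1 h2 h
  have h3 : Commute T (lieAct t (pauli a b * pauli c d - pauli c d * pauli a b)) := by
    rw [lieAct_bracket]
    exact (h1.mul_right h2).sub_right (h2.mul_right h1)
  rw [pauli_commutator, map_smul] at h3
  have h0 : sgn b c - sgn d a ≠ 0 := by
    rcases sgn_eq_or b c with e1 | e1 <;> rcases sgn_eq_or d a with e2 | e2 <;>
      rw [e1, e2] at h ⊢ <;> norm_num at h <;> norm_num
  have := h3.smul_right (sgn b c - sgn d a)⁻¹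
  rwa [smul_smul, inv_mul_cancel₀ h0, one_smul] at this

theorem commutingLabel_zero : CommutingLabel T 0 0 := by
  rw [CommutingLabel, pauli_zero_zero, ← Matrix.diagonal_one, lieAct_diagonal]
  have : (Matrix.diagonal fun a : Fin t → Fin n → Fin 2 => ∑ _i : Fin t, (1 : ℂ)) =
      (t : ℂ) • (1 : Matrix (Fin t → Fin n → Fin 2) (Fin t → Fin n → Fin 2) ℂ) := by
    rw [Matrix.smul_one_eq_diagonal]; simp
  rw [this]
  exact (Commute.one_right T).smul_right _

theorem InseparableSupports.exists_mem {Γ : Finset (Finset (Fin n))} (hΓ : InseparableSupports Γ)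
    (hn : 2 ≤ n) (i : Fin n) : ∃ γ ∈ Γ, i ∈ γ := by
  by_contra! h
  refine hΓ ⟨{i}, {i}ᶜ, Finset.singleton_nonempty i, ?_, Finset.inter_compl _,
    Finset.union_compl _, fun γ hγ => Or.inr fun j hj => ?_⟩
  · rw [← Finset.card_pos, Finset.card_compl, Finset.card_singleton, Fintype.card_fin]
    omega
  · rw [Finset.mem_compl, Finset.mem_singleton]
    rintro rfl
    exact h γ hγ hj

/-- A transitive relation that links any two members of each support links all qubits. -/
theorem InseparableSupports.forall_rel {Γ : Finset (Finset (Fin n))}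
    (hΓ : InseparableSupports Γ) {r : Fin n → Fin n → Prop}
    (hr : ∀ γ ∈ Γ, ∀ i ∈ γ, ∀ j ∈ γ, i ≠ j → r i j)
    (htrans : ∀ i j k, i ≠ j → j ≠ k → i ≠ k → r i j → r j k → r i k) {i j : Fin n}
    (hij : i ≠ j) : r i j := by
  classical
  by_contra h
  -- The class of `i` and its complement would separate `Γ`.
  refine hΓ ⟨Finset.univ.filter fun k => i = k ∨ r i k,
    (Finset.univ.filter fun k => i = k ∨ r i k)ᶜ, ⟨i, by simp⟩, ⟨j, by simp [hij, h]⟩,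
    Finset.inter_compl _, Finset.union_compl _, fun γ hγ => ?_⟩
  by_contra! hcon
  obtain ⟨u, hu, hu'⟩ := Finset.not_subset.mp hcon.2
  obtain ⟨w, hw, hw'⟩ := Finset.not_subset.mp hcon.1
  simp only [Finset.mem_compl, Finset.mem_filter, Finset.mem_univ, true_and] at hu' hw'
  rw [not_not] at hu'
  rw [not_or] at hw'
  have huw : u ≠ w := by
    rintro rfl
    rcases hu' with h' | h'
    · exact hw'.1 h'
    · exact hw'.2 h'
  rcases hu' with rfl | hu'
  · exact hw'.2 (hr γ hγ _ hu _ hw huw)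
  · by_cases hiu : i = u
    · subst hiu
      exact hw'.2 (hr γ hγ _ hu _ hw huw)
    · exact hw'.2 (htrans i u w hiu huw hw'.1 hu' (hr γ hγ _ hu _ hw huw))

theorem sgn_one_add_single (x : Fin n → Fin 2) (i : Fin n) :
    sgn 1 (x + Pi.single i 1) = -sgn 1 x := by
  rw [sgn_add_right, sgn_comm 1 (Pi.single i 1), sgn_single_left]
  simp [bitSign]

theorem commutingLabel_of_local {Γ : Finset (Finset (Fin n))} (hΓ : InseparableSupports Γ)
    (hn : 2 ≤ n)
    (hT : ∀ γ ∈ Γ, ∀ U : localSymUnitary (z2Rep n) γ, Commute T (tensorPow t U.1.1.1))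
    {a : Fin n → Fin 2} (ha : sgn 1 a = 1) (b : Fin n → Fin 2) (hab : a ≠ 0 ∨ b ≠ 1) :
    CommutingLabel T a b := by
  have hz : ∀ i, CommutingLabel T 0 (Pi.single i 1) := fun i => by
    obtain ⟨γ, hγ, hi⟩ := hΓ.exists_mem hn i
    refine commute_lieAct_local_pauli_right (hT γ hγ) fun j hj => ?_
    exact Pi.single_eq_of_ne (ne_of_mem_of_not_mem hi hj).symm _
  have hsupp : ∀ γ : Finset (Fin n), ∀ i ∈ γ, ∀ j ∈ γ, ∀ k, k ∉ γ →
      (Pi.single i 1 + Pi.single j 1 : Fin n → Fin 2) k = 0 := fun γ i hi j hj k hk => by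
    rw [Pi.add_apply, Pi.single_eq_of_ne (ne_of_mem_of_not_mem hi hk).symm,
      Pi.single_eq_of_ne (ne_of_mem_of_not_mem hj hk).symm, add_zero]
  have hpair : ∀ γ ∈ Γ, ∀ i ∈ γ, ∀ j ∈ γ, i ≠ j → Coupled (CommutingLabel T) i j :=
    fun γ hγ i hi j hj _ => by
      refine ⟨commute_lieAct_local_pauli_left (hT γ hγ) (hsupp γ i hi j hj) ?_,
        commute_lieAct_local_pauli_right (hT γ hγ) (hsupp γ i hi j hj)⟩
      rw [sgn_one_add_single, sgn_comm, sgn_single_left]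
      simp [bitSign]
  have hc : ∀ i j, i ≠ j → Coupled (CommutingLabel T) i j := fun i j hij =>
    hΓ.forall_rel hpair
      (fun i j k h1 h2 h3 => commutatorClosed_commutingLabel.coupled_trans hz h1 h2 h3) hij
  exact commutatorClosed_commutingLabel.even commutingLabel_zero hz hc ha b hab

/-! ## Parity classes and the missing diagonal generator -/

/-- The bit strings of a given parity. -/
def parityClass (n : ℕ) (s : ℂ) : Finset (Fin n → Fin 2) :=
  Finset.univ.filter fun x => sgn 1 x = s

theorem card_parityClass_neg (i : Fin n) (s : ℂ) :
    (parityClass n (-s)).card = (parityClass n s).card := by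
  refine Finset.card_bij (fun x _ => x + Pi.single i 1) (fun x hx => ?_)
    (fun x _ y _ h => add_right_cancel h) (fun y hy => ⟨y + Pi.single i 1, ?_, ?_⟩)
  · simp only [parityClass, Finset.mem_filter, Finset.mem_univ, true_and] at hx ⊢
    rw [sgn_one_add_single, hx, neg_neg]
  · simp only [parityClass, Finset.mem_filter, Finset.mem_univ, true_and] at hy ⊢
    rw [sgn_one_add_single, hy]
  · rw [add_assoc, string_add_self, add_zero]

theorem card_parityClass (hn : 1 ≤ n) {s : ℂ} (hs : s = 1 ∨ s = -1) :
    (parityClass n s).card = 2 ^ (n - 1) := by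
  have hneg := card_parityClass_neg (⟨0, hn⟩ : Fin n) s
  have hdisj : Disjoint (parityClass n s) (parityClass n (-s)) := by
    refine Finset.disjoint_left.mpr fun x hx hx' => ?_
    simp only [parityClass, Finset.mem_filter, Finset.mem_univ, true_and] at hx hx'
    rw [hx] at hx'
    rcases hs with rfl | rfl <;> norm_num at hx'
  have hunion : parityClass n s ∪ parityClass n (-s) = Finset.univ := by
    ext x
    simp only [parityClass, Finset.mem_union, Finset.mem_filter, Finset.mem_univ, true_and,
      iff_true]
    rcases hs with rfl | rfl
    · exact sgn_eq_or 1 x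
    · rw [neg_neg]; exact (sgn_eq_or 1 x).symm
  have h := Finset.card_union_of_disjoint hdisj
  rw [hunion, hneg, Finset.card_univ, Fintype.card_fun, Fintype.card_fin, Fintype.card_fin] at h
  obtain ⟨m, rfl⟩ : ∃ m, n = m + 1 := ⟨n - 1, by omega⟩
  rw [pow_succ] at h
  simp only [Nat.add_sub_cancel]
  omega

theorem exists_parity_notMem_range (hn : 1 ≤ n) (ht : t < 2 ^ (n - 1)) (a : Fin t → Fin n → Fin 2)
    {s : ℂ} (hs : s = 1 ∨ s = -1) : ∃ x, sgn 1 x = s ∧ ∀ i, a i ≠ x := by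
  by_contra! h
  have hsub : parityClass n s ⊆ Finset.univ.image a := fun x hx => by
    simp only [parityClass, Finset.mem_filter, Finset.mem_univ, true_and] at hx
    obtain ⟨i, hi⟩ := h x hx
    exact Finset.mem_image.mpr ⟨i, Finset.mem_univ i, hi⟩
  have h1 := (Finset.card_le_card hsub).trans Finset.card_image_le
  rw [card_parityClass hn hs, Finset.card_univ, Fintype.card_fin] at h1
  omega

/-- By Fourier inversion the multiplicities of `x` in `a` and `a'` differ by `c * sgn 1 x` with `c`
independent of `x`. At an even and an odd string absent from `a`, both differences are nonpositive
but opposite, so `c = 0`. -/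
theorem sum_parity_eq (hn : 1 ≤ n) (ht : t < 2 ^ (n - 1)) {a a' : Fin t → Fin n → Fin 2}
    (h : ∀ b, b ≠ 1 → ∑ i, sgn b (a i) = ∑ i, sgn b (a' i)) :
    ∑ i, sgn 1 (a i) = ∑ i, sgn 1 (a' i) := by
  have hcount : ∀ (c : Fin t → Fin n → Fin 2) (x : Fin n → Fin 2),
      ∑ b, sgn b x * ∑ i, sgn b (c i) =
        (2 : ℂ) ^ n * ((Finset.univ.filter fun i => c i = x).card : ℂ) := fun c x => by
    simp only [Finset.mul_sum, ← sgn_add_right]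
    rw [Finset.sum_comm]
    simp only [sum_sgn, string_add_eq_zero_iff, Fintype.card_fin, Finset.card_filter,
      Nat.cast_sum, Finset.mul_sum]
    refine Finset.sum_congr rfl fun i _ => ?_
    by_cases hx : c i = x
    · simp [hx]
    · simp [hx, Ne.symm hx]
  have hdiff : ∀ x, (2 : ℂ) ^ n * ((Finset.univ.filter fun i => a i = x).card : ℂ) -
      (2 : ℂ) ^ n * ((Finset.univ.filter fun i => a' i = x).card : ℂ) =
      sgn 1 x * (∑ i, sgn 1 (a i) - ∑ i, sgn 1 (a' i)) := fun x => by
    rw [← hcount, ← hcount, ← Finset.sum_sub_distrib, Finset.sum_eq_single 1]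
    · rw [mul_sub]
    · intro b _ hb
      rw [h b hb, sub_self]
    · simp
  obtain ⟨x, hx, hxa⟩ := exists_parity_notMem_range hn ht a (Or.inl rfl)
  obtain ⟨y, hy, hya⟩ := exists_parity_notMem_range hn ht a (Or.inr rfl)
  have h1 := hdiff x
  have h2 := hdiff y
  rw [hx, Finset.filter_false_of_mem fun i _ => hxa i] at h1
  rw [hy, Finset.filter_false_of_mem fun i _ => hya i] at h2
  simp only [Finset.card_empty, Nat.cast_zero, mul_zero, zero_sub, one_mul, neg_mul] at h1 h2
  -- Adding the two equations cancels `c`; two natural numbers with sum zero both vanish.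
  have h3 : (2 : ℂ) ^ n * (((Finset.univ.filter fun i => a' i = x).card +
      (Finset.univ.filter fun i => a' i = y).card : ℕ) : ℂ) = 0 := by
    push_cast
    linear_combination -h1 - h2
  have h4 := (mul_eq_zero.mp h3).resolve_left (pow_ne_zero _ two_ne_zero)
  rw [Nat.cast_eq_zero, Nat.add_eq_zero_iff] at h4
  rw [h4.1, Nat.cast_zero, mul_zero, neg_zero] at h1
  exact sub_eq_zero.mp h1.symm

/-- Commuting with a diagonal matrix means that nonzero entries of `T` join equal weights, so
`sum_parity_eq` applies to each such entry. -/
theorem commutingLabel_parity (hn : 1 ≤ n) (ht : t < 2 ^ (n - 1))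
    (h : ∀ b, b ≠ 1 → CommutingLabel T 0 b) : CommutingLabel T 0 1 := by
  have hd : ∀ b : Fin n → Fin 2, CommutingLabel T 0 b ↔
      ∀ a a', T a a' * ∑ i, sgn b (a' i) = (∑ i, sgn b (a i)) * T a a' := fun b => by
    rw [CommutingLabel, pauli_zero_left, lieAct_diagonal, Commute, SemiconjBy, ← Matrix.ext_iff]
    simp only [Matrix.mul_diagonal, Matrix.diagonal_mul]
  rw [hd]
  intro a a'
  by_cases h0 : T a a' = 0
  · simp [h0]
  · rw [mul_comm, sum_parity_eq hn ht (a := a) (a' := a')]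
    intro b hb
    have := (hd b).mp (h b hb) a a'
    rw [mul_comm] at this
    exact (mul_right_cancel₀ h0 this).symm

/-- A symmetric matrix is block diagonal, and a matrix unit inside a parity block is a combination
of `X^a Z^b` with `a` even. -/
theorem commute_lieAct_of_commutingLabel
    (hT : ∀ a b, sgn 1 a = 1 → CommutingLabel T a b)
    {A : Matrix (Fin n → Fin 2) (Fin n → Fin 2) ℂ} (hA : Commute A (pauli 0 1)) :
    Commute T (lieAct t A) := by
  rw [Matrix.matrix_eq_sum_single A, map_sum]
  refine Commute.sum_right _ _ _ fun x _ => ?_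
  rw [map_sum]
  refine Commute.sum_right _ _ _ fun y _ => ?_
  by_cases hxy : sgn 1 x = sgn 1 y
  · have h2 : (2 : ℂ) ^ Fintype.card (Fin n) ≠ 0 := pow_ne_zero _ two_ne_zero
    have h3 : Matrix.single x y (A x y) = (A x y * ((2 : ℂ) ^ Fintype.card (Fin n))⁻¹) •
        ∑ b : Fin n → Fin 2, sgn b y • pauli (x + y) b := by
      rw [sum_sgn_smul_pauli, smul_smul, mul_assoc, inv_mul_cancel₀ h2, mul_one,
        Matrix.smul_single, smul_eq_mul, mul_one]
    rw [h3, map_smul, map_sum]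
    refine Commute.smul_right (Commute.sum_right _ _ _ fun b _ => ?_) _
    rw [map_smul]
    refine Commute.smul_right (hT _ _ ?_) _
    rw [sgn_add_right, hxy, sgn_mul_self]
  · rw [commute_parity_apply hA hxy, Matrix.single_zero, map_zero]
    exact Commute.zero_right T

theorem commute_tensorPow_of_local {Γ : Finset (Finset (Fin n))} (hΓ : InseparableSupports Γ)
    (hn : 2 ≤ n) (ht : t < 2 ^ (n - 1))
    (hT : ∀ γ ∈ Γ, ∀ U : localSymUnitary (z2Rep n) γ, Commute T (tensorPow t U.1.1.1))
    (U : symUnitary (z2Rep n)) : Commute T (tensorPow t U.1.1) := by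
  have hlabel : ∀ a b, sgn 1 a = 1 → CommutingLabel T a b := fun a b ha => by
    by_cases hab : a ≠ 0 ∨ b ≠ 1
    · exact commutingLabel_of_local hΓ hn hT ha b hab
    · push Not at hab
      rw [hab.1, hab.2]
      exact commutingLabel_parity (by omega) ht fun b hb =>
        commutingLabel_of_local hΓ hn hT (sgn_zero_right _) b (Or.inr hb)
  obtain ⟨X, hX, hcomm⟩ := exists_exp_eq_unitary U.1
  have h1 := mem_symUnitary_z2Rep_iff.mp U.2
  have h2 : Commute (star U.1.1) (pauli 0 1) := by
    have := h1.star_star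
    rwa [star_pauli _ _ (sgn_zero_left _)] at this
  rw [← hX, tensorPow_exp]
  exact (commute_lieAct_of_commutingLabel hlabel (hcomm _ h1 h2)).exp_right

end Symmetric

/-! ## Determinants as matrix coefficients of tensor powers -/

section Determinant

variable {ι : Type} [DecidableEq ι] {N : ℕ}

/-- The antisymmetric tensor `e₁ ∧ ⋯ ∧ e_N`. -/
def detTensor (e a : Fin N → ι) : ℂ :=
  Matrix.det (Matrix.of fun i j => if a i = e j then (1 : ℂ) else 0)

theorem detTensor_self {e : Fin N → ι} (he : Function.Injective e) : detTensor e e = 1 := by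
  have : (Matrix.of fun i j => if e i = e j then (1 : ℂ) else 0) = 1 := by
    ext i j
    simp [Matrix.one_apply, he.eq_iff]
  rw [detTensor, this, Matrix.det_one]

/-- Since `A` preserves the span of `e`, the submatrix factors through the square block on `e`. -/
theorem det_submatrix_eq_detTensor_mul {A : Matrix ι ι ℂ} {e : Fin N → ι}
    (he : Function.Injective e) (hA : ∀ x j, x ∉ Set.range e → A x (e j) = 0) (a : Fin N → ι) :
    (A.submatrix a e).det = detTensor e a * (A.submatrix e e).det := by
  rw [detTensor, ← Matrix.det_mul]
  congr 1
  ext i j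
  simp only [Matrix.submatrix_apply, Matrix.mul_apply, Matrix.of_apply, ite_mul, one_mul, zero_mul]
  by_cases h : a i ∈ Set.range e
  · obtain ⟨k, hk⟩ := h
    rw [← hk, Finset.sum_eq_single k]
    · simp
    · intro l _ hl
      rw [if_neg fun h => hl (he h).symm]
    · simp
  · rw [hA _ j h]
    refine (Finset.sum_eq_zero fun k _ => if_neg fun hk => h ⟨k, hk.symm⟩).symm

variable [Fintype ι]

/-- Expand the determinant by Leibniz; each permutation contributes a product of one-site sums. -/
theorem sum_prod_mul_detTensor (A : Matrix ι ι ℂ) (e a : Fin N → ι) :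
    ∑ a' : Fin N → ι, (∏ i, A (a i) (a' i)) * detTensor e a' =
      (A.submatrix a e).det := by
  have hdet : ∀ B : Matrix (Fin N) (Fin N) ℂ,
      B.det = ∑ σ : Equiv.Perm (Fin N), ((Equiv.Perm.sign σ : ℤ) : ℂ) * ∏ i, B i (σ i) := fun B => by
    rw [← Matrix.det_transpose, Matrix.det_apply']
    rfl
  simp only [detTensor, hdet, Finset.mul_sum]
  rw [Finset.sum_comm]
  refine Finset.sum_congr rfl fun σ _ => ?_
  have hterm : ∀ a' : Fin N → ι, (∏ i, A (a i) (a' i)) * (((Equiv.Perm.sign σ : ℤ) : ℂ) *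
      ∏ i, (Matrix.of fun i j => if a' i = e j then (1 : ℂ) else 0) i (σ i)) =
      ((Equiv.Perm.sign σ : ℤ) : ℂ) *
        ∏ i, A (a i) (a' i) * (if a' i = e (σ i) then (1 : ℂ) else 0) := fun a' => by
    rw [mul_left_comm, Finset.prod_mul_distrib]
    rfl
  simp only [hterm, ← Finset.mul_sum]
  congr 1
  have := Finset.prod_univ_sum (fun _ : Fin N => (Finset.univ : Finset ι))
    fun i x => A (a i) x * (if x = e (σ i) then (1 : ℂ) else 0)
  rw [Fintype.piFinset_univ] at this
  simpa using this.symm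

theorem momentRep_mulVec_detTensor {U : Matrix.unitaryGroup ι ℂ} {e o : Fin N → ι}
    (he : Function.Injective e) (ho : Function.Injective o)
    (hUe : ∀ x j, x ∉ Set.range e → U.1 x (e j) = 0)
    (hUo : ∀ x j, x ∉ Set.range o → U.1 x (o j) = 0) :
    momentRep ι N U *ᵥ (fun a => detTensor e a.1 * detTensor o a.2) =
      ((U.1.submatrix e e).det * star (U.1.submatrix o o).det) •
        fun a => detTensor e a.1 * detTensor o a.2 := by
  ext ⟨a, b⟩
  have h1 := sum_prod_mul_detTensor U.1 e a
  have h2 := sum_prod_mul_detTensor (U.1.map star) o b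
  rw [det_submatrix_eq_detTensor_mul he hUe] at h1
  rw [det_submatrix_eq_detTensor_mul ho fun x j hx => by
    rw [Matrix.map_apply, hUo x j hx, star_zero]] at h2
  have h3 : ((U.1.map star).submatrix o o).det = star (U.1.submatrix o o).det := by
    rw [← Matrix.det_conjTranspose, ← Matrix.det_transpose]
    rfl
  rw [h3] at h2
  simp only [Matrix.mulVec, dotProduct, momentRep_apply, Pi.smul_apply, smul_eq_mul,
    Fintype.sum_prod_type]
  calc _ = (∑ a' : Fin N → ι, (∏ i, U.1 (a i) (a' i)) * detTensor e a') *
        ∑ b' : Fin N → ι, (∏ i, (U.1.map star) (b i) (b' i)) * detTensor o b' := by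
        rw [Finset.sum_mul_sum]
        refine Finset.sum_congr rfl fun a' _ => Finset.sum_congr rfl fun b' _ => ?_
        simp only [Matrix.map_apply]
        ring
    _ = _ := by rw [h1, h2]; ring

/-- The tensor `v` on `t` pairs of factors extended by an invariant pairing of one more pair. -/
def extendPair {t : ℕ} (v : (Fin t → ι) × (Fin t → ι) → ℂ) :
    (Fin (t + 1) → ι) × (Fin (t + 1) → ι) → ℂ :=
  fun a => if a.1 0 = a.2 0 then v (Fin.tail a.1, Fin.tail a.2) else 0

/-- Unitarity says that `U ⊗ U^*` fixes the vector `∑ x, e_x ⊗ e_x` of the added pair. -/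
theorem momentRep_mulVec_extendPair {t : ℕ} (U : Matrix.unitaryGroup ι ℂ)
    (v : (Fin t → ι) × (Fin t → ι) → ℂ) :
    momentRep ι (t + 1) U *ᵥ extendPair v = extendPair (momentRep ι t U *ᵥ v) := by
  have hsum : ∀ f : (Fin (t + 1) → ι) → ℂ,
      ∑ a, f a = ∑ x : ι, ∑ a : Fin t → ι, f (Fin.cons x a) := fun f => by
    rw [← Equiv.sum_comp (Fin.consEquiv fun _ => ι), Fintype.sum_prod_type]
    rfl
  ext ⟨a, b⟩
  simp only [Matrix.mulVec, dotProduct, momentRep_apply, Fintype.sum_prod_type, extendPair, hsum,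
    Fin.prod_univ_succ, Fin.cons_zero, Fin.cons_succ, Fin.tail_cons]
  have hU : ∑ x, U.1 (a 0) x * star (U.1 (b 0) x) = if a 0 = b 0 then 1 else 0 := by
    have := congrFun (congrFun (Matrix.mem_unitaryGroup_iff.mp U.2) (a 0)) (b 0)
    rwa [Matrix.mul_apply, Matrix.one_apply] at this
  calc _ = (∑ x, U.1 (a 0) x * star (U.1 (b 0) x)) * ∑ a' : Fin t → ι, ∑ b' : Fin t → ι,
        (∏ i, U.1 (Fin.tail a i) (a' i)) * (∏ i, star (U.1 (Fin.tail b i) (b' i))) *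
          v (a', b') := by
        rw [Finset.sum_mul]
        refine Finset.sum_congr rfl fun x _ => ?_
        rw [Finset.mul_sum]
        refine Finset.sum_congr rfl fun a' _ => ?_
        rw [Finset.sum_eq_single x]
        · rw [Finset.mul_sum]
          refine Finset.sum_congr rfl fun b' _ => ?_
          rw [if_pos rfl]
          simp only [Fin.tail]
          ring
        · intro y _ hy
          exact Finset.sum_eq_zero fun b' _ => by rw [if_neg hy.symm, mul_zero]
        · simp
    _ = _ := by rw [hU, ite_mul, one_mul, zero_mul]

/-- A vector transforming by a character in the `N`-th moment representation yields one in every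
higher moment representation. -/
theorem exists_eigenvector_of_le {N t : ℕ} (h : N ≤ t) {s : Set (Matrix.unitaryGroup ι ℂ)}
    [Nonempty ι] {χ : Matrix.unitaryGroup ι ℂ → ℂ}
    (hN : ∃ v : (Fin N → ι) × (Fin N → ι) → ℂ, v ≠ 0 ∧
      ∀ U ∈ s, momentRep ι N U *ᵥ v = χ U • v) :
    ∃ v : (Fin t → ι) × (Fin t → ι) → ℂ, v ≠ 0 ∧ ∀ U ∈ s, momentRep ι t U *ᵥ v = χ U • v := by
  induction t, h using Nat.le_induction with
  | base => exact hN
  | succ t _ ih =>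
    obtain ⟨v, hv0, hv⟩ := ih
    refine ⟨extendPair v, fun h0 => ?_, fun U hU => ?_⟩
    · obtain ⟨⟨a, b⟩, hab⟩ := Function.ne_iff.mp hv0
      let x := Classical.arbitrary ι
      have := congrFun h0 (Fin.cons x a, Fin.cons x b)
      simp only [extendPair, Fin.cons_zero, if_true, Fin.tail_cons] at this
      exact hab this
    · rw [momentRep_mulVec_extendPair, hv U hU]
      ext a
      simp [extendPair]

/-- The rows in `range e` vanish outside it, so the block is itself unitary. -/
theorem det_submatrix_mul_star {U : Matrix.unitaryGroup ι ℂ} {e : Fin N → ι}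
    (he : Function.Injective e) (hU : ∀ i x, x ∉ Set.range e → U.1 (e i) x = 0) :
    (U.1.submatrix e e).det * star (U.1.submatrix e e).det = 1 := by
  rw [← Matrix.det_conjTranspose, ← Matrix.det_mul]
  convert Matrix.det_one (n := Fin N) (R := ℂ)
  ext i j
  have h1 := congrFun (congrFun (Matrix.mem_unitaryGroup_iff.mp U.2) (e i)) (e j)
  rw [Matrix.mul_apply] at h1
  rw [Matrix.mul_apply, Fintype.sum_of_injective e he
    (g := fun x => U.1 (e i) x * (star U.1) x (e j)), h1]
  · simp [Matrix.one_apply, he.eq_iff]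
  · intro x hx
    rw [hU i x hx, zero_mul]
  · intro k
    rfl

end Determinant

/-! ## The relative determinant of the two parity sectors -/

section Parity

variable {n : ℕ}

theorem mem_parityClass {s : ℂ} {x : Fin n → Fin 2} : x ∈ parityClass n s ↔ sgn 1 x = s := by
  simp [parityClass]

/-- An enumeration of the bit strings of parity `s`. -/
theorem exists_parity_enumeration (hn : 1 ≤ n) {s : ℂ} (hs : s = 1 ∨ s = -1) :
    ∃ e : Fin (2 ^ (n - 1)) → Fin n → Fin 2, Function.Injective e ∧
      ∀ x, x ∈ Set.range e ↔ sgn 1 x = s := by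
  have e := (parityClass n s).equivFinOfCardEq (card_parityClass hn hs)
  refine ⟨fun j => e.symm j, Subtype.val_injective.comp e.symm.injective, fun x => ?_⟩
  rw [← mem_parityClass]
  exact ⟨fun ⟨j, hj⟩ => hj ▸ (e.symm j).2, fun hx => ⟨e ⟨x, hx⟩, by simp⟩⟩

/-- The flip `X_i` acts on the factor where `V ⊗ 1` is the identity. -/
theorem embedMatrix_flip {γ : Finset (Fin n)} {i : Fin n} (hi : i ∉ γ)
    (V : Matrix ({q // q ∈ γ} → Fin 2) ({q // q ∈ γ} → Fin 2) ℂ) (x y : Fin n → Fin 2) :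
    embedMatrix γ V (x + Pi.single i 1) (y + Pi.single i 1) = embedMatrix γ V x y := by
  have h1 : ∀ x : Fin n → Fin 2, (splitBits γ (x + Pi.single i 1)).1 = (splitBits γ x).1 :=
    fun x => by
      ext1 j
      change (x + Pi.single i 1 : Fin n → Fin 2) j.1 = x j.1
      rw [Pi.add_apply, Pi.single_eq_of_ne (ne_of_mem_of_not_mem j.2 hi), add_zero]
  have h2 : ∀ x : Fin n → Fin 2, (splitBits γ (x + Pi.single i 1)).2 =
      (splitBits γ x).2 + (splitBits γ (Pi.single i 1)).2 := fun x => rfl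
  simp only [embedMatrix, Matrix.submatrix_apply, Matrix.kroneckerMap_apply, h1, h2,
    Matrix.one_apply, add_left_inj]

/-- The flip matches the two enumerations up to a permutation, which does not affect the determinant
when applied to rows and columns alike. -/
theorem det_submatrix_eq_of_flip {N : ℕ} {A : Matrix (Fin n → Fin 2) (Fin n → Fin 2) ℂ} {i : Fin n}
    (hA : ∀ x y, A (x + Pi.single i 1) (y + Pi.single i 1) = A x y) {e o : Fin N → Fin n → Fin 2}
    (he : Function.Injective e) (hoe : ∀ j, e j + Pi.single i 1 ∈ Set.range o) :
    (A.submatrix e e).det = (A.submatrix o o).det := by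
  choose σ hσ using hoe
  have hinj : Function.Injective σ := fun j k h => by
    have := hσ j
    rw [h, hσ k] at this
    exact (he (add_right_cancel this)).symm
  let τ := Equiv.ofBijective σ (Finite.injective_iff_bijective.mp hinj)
  rw [← Matrix.det_submatrix_equiv_self τ (A.submatrix o o)]
  congr 1
  ext j k
  change A (e j) (e k) = A (o (σ j)) (o (σ k))
  rw [hσ, hσ, hA]

theorem not_isAsymptoticSymmetricDesign {t : ℕ} (hn : 1 ≤ n) (ht : 2 ^ (n - 1) ≤ t)
    {Γ : Finset (Finset (Fin n))} (hΓ : ∀ γ ∈ Γ, γ ≠ Finset.univ) {p : Finset (Fin n) → ℝ}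
    (hp : ∀ γ ∈ Γ, 0 < p γ) (hsum : ∑ γ ∈ Γ, p γ = 1) :
    ¬ IsAsymptoticSymmetricDesign (z2Rep n) t (circuitDist (z2Rep n) Γ p) := by
  intro hdesign
  obtain ⟨e, he, her⟩ := exists_parity_enumeration hn (s := 1) (Or.inl rfl)
  obtain ⟨o, ho, hor⟩ := exists_parity_enumeration hn (s := -1) (Or.inr rfl)
  have hblock : ∀ {s : ℂ} {f : Fin (2 ^ (n - 1)) → Fin n → Fin 2},
      (∀ x, x ∈ Set.range f ↔ sgn 1 x = s) → ∀ U ∈ symUnitary (z2Rep n),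
      ∀ x j, x ∉ Set.range f → U.1 x (f j) = 0 ∧ U.1 (f j) x = 0 := fun {s f} hf U hU x j hx => by
    have hU' := mem_symUnitary_z2Rep_iff.mp hU
    rw [hf] at hx
    have hj := (hf (f j)).mp ⟨j, rfl⟩
    exact ⟨commute_parity_apply hU' (by rwa [hj]), commute_parity_apply hU' (by
      rw [hj]; exact Ne.symm hx)⟩
  obtain ⟨v, hv0, hv⟩ := exists_eigenvector_of_le ht (s := symUnitary (z2Rep n))
    (χ := fun U => (U.1.submatrix e e).det * star (U.1.submatrix o o).det)
    ⟨fun a => detTensor e a.1 * detTensor o a.2, fun h => by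
      have := congrFun h (e, o)
      simp [detTensor_self he, detTensor_self ho] at this,
    fun U hU => momentRep_mulVec_detTensor he ho (fun x j hx => (hblock her U hU x j hx).1)
      fun x j hx => (hblock hor U hU x j hx).1⟩
  have hfix : ∀ γ ∈ Γ, ∀ U : localSymUnitary (z2Rep n) γ,
      momentRep (Fin n → Fin 2) t U.1.1 *ᵥ v = v := fun γ hγ U => by
    obtain ⟨i, hi⟩ : ∃ i, i ∉ γ := by
      by_contra! h
      exact hΓ γ hγ (Finset.eq_univ_of_forall h)
    obtain ⟨V, hV⟩ := U.2
    have hV' : U.1.1.1 = embedMatrix γ V.1 := congrArg Subtype.val hV.symm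
    have hdet : (U.1.1.1.submatrix e e).det = (U.1.1.1.submatrix o o).det := by
      refine det_submatrix_eq_of_flip (i := i) (fun x y => ?_) he fun j => ?_
      · rw [hV', embedMatrix_flip hi]
      · rw [hor, sgn_one_add_single, (her _).mp ⟨j, rfl⟩]
    rw [hv _ U.1.2, hdet, det_submatrix_mul_star ho fun j x hx => (hblock hor _ U.1.2 x j hx).2, one_smul]
  -- A sign change on a single even string has determinants `-1` and `1` on the two sectors, so the
  -- character takes the value `-1`.
  let j₀ : Fin (2 ^ (n - 1)) := ⟨0, by positivity⟩
  let d : (Fin n → Fin 2) → ℂ := fun x => if x = e j₀ then -1 else 1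
  have hd : Matrix.diagonal d ∈ Matrix.unitaryGroup (Fin n → Fin 2) ℂ := by
    rw [Matrix.mem_unitaryGroup_iff, Matrix.star_eq_conjTranspose, Matrix.diagonal_conjTranspose,
      Matrix.diagonal_mul_diagonal, ← Matrix.diagonal_one]
    congr 1
    ext x
    simp only [d, Pi.star_apply]
    split_ifs <;> simp
  have hdsym : (⟨Matrix.diagonal d, hd⟩ : Matrix.unitaryGroup (Fin n → Fin 2) ℂ) ∈
      symUnitary (z2Rep n) := by
    rw [mem_symUnitary_z2Rep_iff, pauli_zero_left]
    exact Matrix.commute_diagonal _ _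
  have h1 := momentRep_mulVec_eq_self_of_design hp hsum hdesign hfix ⟨_, hdsym⟩
  rw [hv _ hdsym] at h1
  have he1 : ((Matrix.diagonal d).submatrix e e).det = -1 := by
    rw [Matrix.submatrix_diagonal _ _ he, Matrix.det_diagonal, Finset.prod_eq_single j₀]
    · simp [d]
    · intro j _ hj
      simp [d, he.ne hj]
    · simp
  have ho1 : ((Matrix.diagonal d).submatrix o o).det = 1 := by
    rw [Matrix.submatrix_diagonal _ _ ho, Matrix.det_diagonal]
    refine Finset.prod_eq_one fun j _ => if_neg fun h => ?_
    have h2 := (hor _).mp ⟨j, rfl⟩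
    rw [h, (her _).mp ⟨j₀, rfl⟩] at h2
    norm_num at h2
  simp only [he1, ho1, star_one, mul_one, neg_smul, one_smul] at h1
  exact hv0 (self_eq_neg.mp h1.symm)

end Parity

end SymDesign

end

theorem theorem2 (n k t : ℕ) (ht : 1 ≤ t) (hk : 2 ≤ k) (hn : k + 1 ≤ n)
    (Γ : Finset (Finset (Fin n)))
    (hΓ : SymDesign.InseparableSupports Γ)
    (hmax : IsGreatest {m : ℕ | ∃ γ ∈ Γ, γ.card = m} k)
    (p : Finset (Fin n) → ℝ) (hpos : ∀ γ ∈ Γ, 0 < p γ) (hsum : ∑ γ ∈ Γ, p γ = 1) :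
    SymDesign.IsAsymptoticSymmetricDesign (SymDesign.z2Rep n) t
      (SymDesign.circuitDist (SymDesign.z2Rep n) Γ p) ↔ t < 2 ^ (n - 1) := by
  constructor
  · intro h
    by_contra hlt
    refine SymDesign.not_isAsymptoticSymmetricDesign (by omega) (not_lt.mp hlt)
      (fun γ hγ h' => ?_) hpos hsum h
    -- A support of all `n > k` qubits would exceed the maximal size `k`.
    have := hmax.2 ⟨γ, hγ, rfl⟩
    rw [h', Finset.card_univ, Fintype.card_fin] at this
    omega
  · intro hlt
    exact SymDesign.isAsymptoticSymmetricDesign_of_commute hpos hsum fun T hT U =>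
      SymDesign.commute_tensorPow_of_local hΓ (by omega) hlt hT U
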